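/- **Setting.** Let $\mathcal X$ be a measurable space, $\mathcal Y\subseteq\mathbb R$, $\mathcal Z=\mathcal X\times\mathcal Y$, let $\mathcal H$ be a real Hilbert space and $\Psi\colon\mathcal X\to\mathcal H$ a (strongly measurable) feature map with kernel $K(x,x')=\langle\Psi(x),\Psi(x')\rangle$, and put $r=\big(\sup_{x}K(x,x)\big)^{1/2}$ (with $\Lambda r=0$ if $\Lambda=0$; for $\Lambda>0$ the assumptions below make $r$ finite). Let $p\ge 1$ be real, $\Lambda\in\mathbb R$, $M\ge 1$, and $$\mathcal F=\{(x,y)\mapsto |\langle w,\Psi(x)\rangle-y|^p \;:\; \|w\|_{\mathcal H}\le\Lambda\},\qquad H=\{x\mapsto\langle w,\Psi(x)\rangle \;:\; \|w\|_{\mathcal H}\le\Lambda\}.$$ Assume that $|\langle w,\Psi(x)\rangle-y|\le M$ for all $(x,y)\in\mathcal Z$ and all $\|w\|_{\mathcal H}\le\Lambda$, and that $|f|\le M$ on $\mathcal Z$ for all $f\in\mathcal F$. Let $Z_t=(X_t,Y_t)$, $1\le t\le T+1$, be an arbitrary $\mathcal Z$-valued stochastic process; all conditional expectations $\mathbb E[f(Z_t)\mid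 Z_1^{t-1}]$ are computed from a fixed regular conditional distribution of $Z_t$ given $Z_1^{t-1}=(Z_1,\dots,Z_{t-1})$. For $q\in\mathbb R^T$ let $$\mathrm{disc}(q)=\sup_{f\in\mathcal F}\Big(\mathbb E[f(Z_{T+1})\mid Z_1^T]-\sum_{t=1}^T q_t\,\mathbb E[f(Z_t)\mid Z_1^{t-1}]\Big).$$ **Theorem.** Fix $q^*\in\mathbb R^T$ and $\delta>0$. With probability at least $1-\delta$, for all $h\in H$ and all $q\in\mathbb R^T$ with $0<\|q-q^*\|_1\le 1$, $$\mathbb E\big[|h(X_{T+1})-Y_{T+1}|^p\mid Z_1^T\big]\le\sum_{t=1}^T q_t\,|h(X_t)-Y_t|^p+\mathrm{disc}(q)+G(q)+4M\|q-q^*\|_1,$$ where $$G(q)=4M\Big(\sqrt{2\log\tfrac2\delta}+\sqrt{2\log\log_2\big(2(1-\|q-q^*\|_1)^{-1}\big)}+\widetilde C_T\Lambda r\Big)\Big(\|q^*\|_2+2\|q-q^*\|_1\Big),$$ $$\widetilde C_T=48\,p\,M^p\sqrt{\pi\log T}\,\Big(1+4\sqrt2\,\log^{3/2}(eT^2)\Big),$$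 and $G(q)=+\infty$ if $\|q-q^*\|_1=1$ (the square root of a negative number is read as $0$, which matters only for $\delta>2$). Consequently, for $p=2$, there is a constant $C>0$ depending only on $M$ and $\delta$ such that, whenever $T\ge2$, with probability at least $1-\delta$, for all $h\in H$ and all $q$ with $0<\|q-q^*\|_1\le1$, $$\mathbb E\big[(h(X_{T+1})-Y_{T+1})^2\mid Z_1^T\big]\le\sum_{t=1}^T q_t\,(h(X_t)-Y_t)^2+\mathrm{disc}(q)+C\,(1+\Lambda r)(\log^2T)\Big(1+\sqrt{\log\log_2\big(2(1-\|q-q^*\|_1)^{-1}\big)}\Big)\Big(\|q^*\|_2+\|q-q^*\|_1\Big),$$ where again the right side is $+\infty$ if $\|q-q^*\|_1=1$. -/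

import Mathlib

open MeasureTheory ProbabilityTheory
open scoped RealInnerProductSpace

universe u v w

noncomputable section

namespace Forecast

/-- The history `(Z_0, …, Z_{t-1})` of a process: times are numbered from `0`, so that `Z 0, …, Z (T-1)`
is the observed sample and `Z T` is the observation to be forecast. -/
def past {Ω : Type u} {𝒵 : Type v} (Z : ℕ → Ω → 𝒵) (t : ℕ) (ω : Ω) : Fin t → 𝒵 :=
  fun i => Z i ω

/-- `κ t` is, for every `t ≤ T`, a regular conditional distribution of `Z t` given
`(Z 0, …, Z (t-1))`: a Markov kernel which disintegrates the joint law of the history and `Z t`. -/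
def IsRegularCondLaw {Ω : Type u} {𝒵 : Type v} [MeasurableSpace Ω] [MeasurableSpace 𝒵]
    (μ : Measure Ω) (Z : ℕ → Ω → 𝒵) (T : ℕ) (κ : (t : ℕ) → Kernel (Fin t → 𝒵) 𝒵) : Prop :=
  ∀ t ≤ T, IsMarkovKernel (κ t) ∧
    μ.map (fun ω => (past Z t ω, Z t ω)) = (μ.map (past Z t)) ⊗ₘ (κ t)

/-- The conditional expectation `E[f(Z t) | Z 0, …, Z (t-1)]` at `ω`, computed with the regular
conditional distribution `κ t`. -/
def condMean {Ω : Type u} {𝒵 : Type v} [MeasurableSpace 𝒵] (Z : ℕ → Ω → 𝒵)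
    (κ : (t : ℕ) → Kernel (Fin t → 𝒵) 𝒵) (f : 𝒵 → ℝ) (t : ℕ) (ω : Ω) : ℝ :=
  ∫ z, f z ∂(κ t (past Z t ω))

/-- The discrepancy `disc(q)` of a class `F` of functions, at the realization `ω`. -/
def disc {Ω : Type u} {𝒵 : Type v} [MeasurableSpace 𝒵] (Z : ℕ → Ω → 𝒵)
    (κ : (t : ℕ) → Kernel (Fin t → 𝒵) 𝒵) (F : Set (𝒵 → ℝ)) {T : ℕ} (q : Fin T → ℝ) (ω : Ω) : ℝ :=
  ⨆ f : F, (condMean Z κ f T ω - ∑ t : Fin T, q t * condMean Z κ f t ω)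

/-- The `p`-th power loss of the linear hypothesis `x ↦ ⟪w, Ψ x⟫` at `z = (x, y)`. -/
def powerLoss {𝒳 : Type v} {ℋ : Type w} [NormedAddCommGroup ℋ] [InnerProductSpace ℝ ℋ]
    (Ψ : 𝒳 → ℋ) (p : ℝ) (a : ℋ) (z : 𝒳 × ℝ) : ℝ :=
  |⟪a, Ψ z.1⟫ - z.2| ^ p

/-- The family of the `p`-th power losses of the hypotheses with `‖a‖ ≤ Λ`. -/
def lossClass {𝒳 : Type v} {ℋ : Type w} [NormedAddCommGroup ℋ] [InnerProductSpace ℝ ℋ]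
    (Ψ : 𝒳 → ℋ) (p Λ : ℝ) : Set (𝒳 × ℝ → ℝ) :=
  {f | ∃ a : ℋ, ‖a‖ ≤ Λ ∧ f = powerLoss Ψ p a}

/-- The radius `r` of the feature map: `r ^ 2 = sup_x K(x, x)` for the kernel
`K(x, x') = ⟪Ψ x, Ψ x'⟫`. -/
def featureRadius {𝒳 : Type v} {ℋ : Type w} [NormedAddCommGroup ℋ] [InnerProductSpace ℝ ℋ]
    (Ψ : 𝒳 → ℋ) : ℝ :=
  √(⨆ x, ⟪Ψ x, Ψ x⟫)

/-- The forecasting scenario. `Z t = (X t, Y t)`, for `t ≤ T`, is a process with values in `𝒳 × 𝒴`,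
where `𝒴` is a set of reals; `κ` is its conditional law; the residuals and the losses of the
hypotheses with `‖a‖ ≤ Λ` are bounded by `M` on `𝒳 × 𝒴`. -/
structure IsScenario {Ω : Type u} {𝒳 : Type v} {ℋ : Type w} [MeasurableSpace Ω]
    [MeasurableSpace 𝒳] [NormedAddCommGroup ℋ] [InnerProductSpace ℝ ℋ]
    (μ : Measure Ω) (Z : ℕ → Ω → 𝒳 × ℝ) (κ : (t : ℕ) → Kernel (Fin t → 𝒳 × ℝ) (𝒳 × ℝ))
    (𝒴 : Set ℝ) (Ψ : 𝒳 → ℋ) (T : ℕ) (p Λ M : ℝ) : Prop where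
  measurable_process : ∀ t ≤ T, Measurable (Z t)
  output_mem : ∀ t ≤ T, ∀ ω, (Z t ω).2 ∈ 𝒴
  condLaw : IsRegularCondLaw μ Z T κ
  measurable_feature : StronglyMeasurable Ψ
  residual_le : ∀ x, ∀ y ∈ 𝒴, ∀ a : ℋ, ‖a‖ ≤ Λ → |⟪a, Ψ x⟫ - y| ≤ M
  loss_le : ∀ f ∈ lossClass Ψ p Λ, ∀ x, ∀ y ∈ 𝒴, |f (x, y)| ≤ M

/-- The `ℓ¹` norm of a weight vector. -/
def l1 {T : ℕ} (q : Fin T → ℝ) : ℝ := ∑ t, |q t|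

/-- The `ℓ²` norm of a weight vector. -/
def l2 {T : ℕ} (q : Fin T → ℝ) : ℝ := √(∑ t, q t ^ 2)

/-- `log log₂ (2 (1 - s)⁻¹)`, for `0 < s < 1`. -/
def logLog (s : ℝ) : ℝ := Real.log (Real.logb 2 (2 * (1 - s)⁻¹))

/-- The constant `C̃_T = 48 p M^p √(π log T) (1 + 4 √2 log^{3/2}(e T²))`. -/
def constT (p M : ℝ) (T : ℕ) : ℝ :=
  48 * p * M ^ p * √(Real.pi * Real.log T) *
    (1 + 4 * √2 * Real.log (Real.exp 1 * (T : ℝ) ^ 2) ^ (3 / 2 : ℝ))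

/-- The penalty `G(q)`. It is `+∞` when `‖q - q*‖₁ = 1`, where `(1 - ‖q - q*‖₁)⁻¹ = +∞`. -/
def penalty (p M δ Λ r : ℝ) {T : ℕ} (qs q : Fin T → ℝ) : EReal :=
  if l1 (q - qs) < 1 then
    ((4 * M * (√(2 * Real.log (2 / δ)) + √(2 * logLog (l1 (q - qs))) + constT p M T * Λ * r) *
      (l2 qs + 2 * l1 (q - qs)) : ℝ) : EReal)
  else ⊤

/-- The order of magnitude of the penalty for `p = 2`. It is `+∞` when `‖q - q*‖₁ = 1`. -/
def rate (Λ r : ℝ) {T : ℕ} (qs q : Fin T → ℝ) : EReal :=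
  if l1 (q - qs) < 1 then
    (((1 + Λ * r) * Real.log T ^ 2 * (1 + √(logLog (l1 (q - qs)))) *
      (l2 qs + l1 (q - qs)) : ℝ) : EReal)
  else ⊤

/-- At the realization `ω`, for all hypotheses with `‖a‖ ≤ Λ` and all `q` with
`0 < ‖q - q*‖₁ ≤ 1`: the conditional loss is at most the weighted empirical loss, plus `disc(q)`,
plus the excess `B q`. -/
def UniformBound {Ω : Type u} {𝒳 : Type v} {ℋ : Type w} [MeasurableSpace 𝒳]
    [NormedAddCommGroup ℋ] [InnerProductSpace ℝ ℋ] (Z : ℕ → Ω → 𝒳 × ℝ)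
    (κ : (t : ℕ) → Kernel (Fin t → 𝒳 × ℝ) (𝒳 × ℝ)) (Ψ : 𝒳 → ℋ) (p Λ : ℝ) {T : ℕ}
    (qs : Fin T → ℝ) (B : (Fin T → ℝ) → EReal) (ω : Ω) : Prop :=
  ∀ a : ℋ, ‖a‖ ≤ Λ → ∀ q : Fin T → ℝ, 0 < l1 (q - qs) → l1 (q - qs) ≤ 1 →
    (condMean Z κ (powerLoss Ψ p a) T ω : EReal) ≤
      ((∑ t : Fin T, q t * powerLoss Ψ p a (Z t ω) + disc Z κ (lossClass Ψ p Λ) q ω : ℝ) : EReal)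
        + B q

end Forecast

end

/-! Only the fixed weights `q*` require probability. Conditional means and losses lie in `[0, M]`,
so replacing `q*` by `q` changes `∑ q_t (E[f(Z_t) | past] - f(Z_t))` by at most `M ‖q - q*‖₁`, while
`disc(q)` bounds by definition the gap between the conditional loss at time `T` and the `q`-weighted
conditional losses (`condMean_le_of_deviation`). It remains to bound the sum at `q*`, uniformly over
the ball, by `4M (√(2 log(2/δ)) + C̃_T Λ r) ‖q*‖₂`. The double logarithm in the penalty is slack.

Given the observed path `z`, draw a tangent sequence `z'`: independent coordinates, the one at `t`
having the conditional law of `Z_t` given the past of `z`. The sum to bound is the mean over `z'` of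
`∑ q*_t (f(z'_t) - f(z_t))`. The ball is discretized by perceptrons: one fed with `z` and `z'`,
corrected whenever it departs from `a` by more than `α`, makes at most `(Λr/α)²` updates
(`exists_perceptron`). Times, copies and signs of the updates describe it, so a finite family of
predictors, depending at time `t` only on the past of both samples, contains one that is `α`-close
to `a` except at update times (`exists_expert`).

With `L = p M^(p-1)`, truncated expert losses of precision `M/4^k` are chained (`exists_chain`).
Links are clipped, which keeps failures at update times cheap: by Cauchy–Schwarz each level loses
`O(ΛrL ‖q*‖₂)`. Given both pasts, the increments of a link at `z'_t` and `z_t` are i.i.d., so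
Hoeffding's lemma controls the exponential moments of the weighted sums (`lintegral_exp_walk_le`).
The appropriate expert depends on `z'`, hence a common majorant of all experts is integrated over
`z'` (`exists_majorant`). Level `k` has log-cardinality of order `(4^k ΛrL/M)² log T` and links of
size `M/4^k`; it contributes order `ΛrL √(log T) ‖q*‖₂`. Order `log T` levels give `log^{3/2} T`,
below the order `log² T` of `C̃_T`. -/

namespace Forecast

/-! ### Perceptron experts with few updates. -/

/-- The weight vector at time `t` of the expert that adds `± η x` for the points listed in `S` that
precede `t`. An entry of `S` consists of a time, of the copy of the sample, and of the sign. -/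
noncomputable def weight {ℋ : Type*} [NormedAddCommGroup ℋ] [InnerProductSpace ℝ ℋ]
    (η : ℝ) (S : Finset (ℕ × Bool × Bool)) (t : ℕ) (x : Fin t → Bool → ℋ) : ℋ :=
  ∑ e ∈ S, if h : e.1 < t then (if e.2.2 then η else -η) • x ⟨e.1, h⟩ e.2.1 else 0

/-- The potential `R² ‖w - a‖²` starts at most at `R² Λ²`, and every update lowers it by at least
`α²`. The target `a` is used only to choose `S`; the weights themselves are functions of `S` and of
past points. -/
theorem exists_perceptron {ℋ : Type*} [NormedAddCommGroup ℋ] [InnerProductSpace ℝ ℋ]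
    {x : ℕ → Bool → ℋ} {a : ℋ} {R Λ α : ℝ} (hx : ∀ s b, ‖x s b‖ ≤ R) (ha : ‖a‖ ≤ Λ) (hα : 0 < α)
    (m : ℕ) :
    ∃ S : Finset (ℕ × Bool × Bool), (∀ e ∈ S, e.1 < m) ∧
      S.card * α ^ 2 + R ^ 2 * ‖weight (α / R ^ 2) S m (fun i b => x i b) - a‖ ^ 2
        ≤ R ^ 2 * Λ ^ 2 ∧
      ∀ t < m, (∃ b, α < |⟪weight (α / R ^ 2) S t (fun i b => x i b) - a, x t b⟫|) →
        ∃ e ∈ S, e.1 = t := by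
  have hR : 0 ≤ R := (norm_nonneg _).trans (hx 0 true)
  induction m with
  | zero =>
    refine ⟨∅, by simp, ?_, by simp⟩
    simp only [weight, Finset.card_empty, Finset.sum_empty, zero_sub, norm_neg]
    have := norm_nonneg a
    simp only [CharP.cast_eq_zero, zero_mul, zero_add]
    gcongr
  | succ m ih =>
    obtain ⟨S, hS, hpot, hmis⟩ := ih
    have hstep : weight (α / R ^ 2) S (m + 1) (fun i b => x i b)
        = weight (α / R ^ 2) S m (fun i b => x i b) := by
      unfold weight
      refine Finset.sum_congr rfl fun e he => ?_
      rw [dif_pos (hS e he), dif_pos ((hS e he).trans (Nat.lt_succ_self m))]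
    by_cases hb : ∃ b, α < |⟪weight (α / R ^ 2) S m (fun i b => x i b) - a, x m b⟫|
    · obtain ⟨b, hb⟩ := hb
      set v := weight (α / R ^ 2) S m (fun i b => x i b) with hv
      -- The sign moves the weight against the error, so the cross term of the expanded square is
      -- negative.
      obtain ⟨σ, hσ⟩ : ∃ σ : Bool, (if σ then (1 : ℝ) else -1) * ⟪v - a, x m b⟫
          = -|⟪v - a, x m b⟫| := by
        rcases le_total 0 ⟪v - a, x m b⟫ with h | h
        · exact ⟨false, by simp [abs_of_nonneg h]⟩
        · exact ⟨true, by simp [abs_of_nonpos h]⟩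
      have hnot : (m, b, σ) ∉ S := fun h => lt_irrefl _ (hS _ h)
      have hold : ∀ t ≤ m, weight (α / R ^ 2) (insert (m, b, σ) S) t (fun i b => x i b)
          = weight (α / R ^ 2) S t (fun i b => x i b) := by
        intro t ht
        unfold weight
        rw [Finset.sum_insert hnot, dif_neg (by simpa using ht), zero_add]
      have hR0 : R ≠ 0 := by
        rintro rfl
        have : x m b = 0 := norm_le_zero_iff.1 (hx m b)
        rw [this, inner_zero_right, abs_zero] at hb
        exact absurd hb (not_lt.2 hα.le)
      have hnew : weight (α / R ^ 2) (insert (m, b, σ) S) (m + 1) (fun i b => x i b)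
          = v + ((α / R ^ 2) * (if σ then (1 : ℝ) else -1)) • x m b := by
        rw [weight, Finset.sum_insert hnot, dif_pos (Nat.lt_succ_self m)]
        rw [weight] at hstep
        rw [hstep, add_comm]
        cases σ <;> simp
      refine ⟨insert (m, b, σ) S, ?_, ?_, ?_⟩
      · intro e he
        rcases Finset.mem_insert.1 he with rfl | he
        · exact Nat.lt_succ_self m
        · exact (hS e he).trans (Nat.lt_succ_self m)
      · rw [Finset.card_insert_of_notMem hnot, hnew, add_sub_right_comm, norm_add_sq_real,
          inner_smul_right, norm_smul, mul_assoc (α / R ^ 2), hσ, Real.norm_eq_abs, mul_pow, sq_abs]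
        have hsq : (if σ then (1 : ℝ) else -1) ^ 2 = 1 := by cases σ <;> simp
        rw [mul_pow, hsq]
        have h1 : ‖x m b‖ ^ 2 ≤ R ^ 2 := by gcongr; exact hx m b
        have h2 : R ^ 2 * ((α / R ^ 2) ^ 2 * 1 * ‖x m b‖ ^ 2) ≤ α ^ 2 := by
          calc R ^ 2 * ((α / R ^ 2) ^ 2 * 1 * ‖x m b‖ ^ 2)
              ≤ R ^ 2 * ((α / R ^ 2) ^ 2 * 1 * R ^ 2) := by gcongr
            _ = α ^ 2 := by field_simp
        -- The step `α / R²` makes the cross term at most `-2α²` and the quadratic term at most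
        -- `α²`.
        have h3 : R ^ 2 * (2 * ((α / R ^ 2) * -|⟪v - a, x m b⟫|)) ≤ -2 * α ^ 2 := by
          have : R ^ 2 * (2 * ((α / R ^ 2) * -|⟪v - a, x m b⟫|))
              = -2 * (α * |⟪v - a, x m b⟫|) := by field_simp
          rw [this]
          nlinarith
        push_cast
        nlinarith
      · intro t ht hbt
        rcases Nat.lt_succ_iff_lt_or_eq.1 ht with h | rfl
        · rw [hold t h.le] at hbt
          obtain ⟨e, he, het⟩ := hmis t h hbt
          exact ⟨e, Finset.mem_insert_of_mem he, het⟩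
        · exact ⟨_, Finset.mem_insert_self _ _, rfl⟩
    · refine ⟨S, fun e he => (hS e he).trans (Nat.lt_succ_self m), by rwa [hstep], ?_⟩
      intro t ht hbt
      rcases Nat.lt_succ_iff_lt_or_eq.1 ht with h | rfl
      · exact hmis t h hbt
      · exact absurd hbt hb

/-- The lists of at most `d` updates before time `T`. -/
def updates (T d : ℕ) : Finset (Finset (ℕ × Bool × Bool)) :=
  (Finset.range T ×ˢ (Finset.univ : Finset (Bool × Bool))).powerset.filter (·.card ≤ d)

theorem card_powerset_filter_card_le {α : Type*} [DecidableEq α] (s : Finset α) (d : ℕ) :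
    (s.powerset.filter (·.card ≤ d)).card ≤ (s.card + 1) ^ d := by
  induction d with
  | zero =>
    have : s.powerset.filter (·.card ≤ 0) = {∅} := by
      ext t
      simp only [Finset.mem_filter, Finset.mem_powerset, nonpos_iff_eq_zero, Finset.card_eq_zero,
        Finset.mem_singleton]
      exact ⟨And.right, fun h => ⟨h ▸ Finset.empty_subset s, h⟩⟩
    rw [this, Finset.card_singleton, pow_zero]
  | succ d ih =>
    have hsub : s.powerset.filter (·.card ≤ d + 1) ⊆
        (s.powerset.filter (·.card ≤ d)) ∪
          (s ×ˢ s.powerset.filter (·.card ≤ d)).image (fun p => insert p.1 p.2) := by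
      intro t ht
      simp only [Finset.mem_filter, Finset.mem_powerset] at ht
      rcases t.eq_empty_or_nonempty with rfl | ⟨a, ha⟩
      · simp
      · refine Finset.mem_union_right _ (Finset.mem_image.2 ⟨(a, t.erase a), ?_, ?_⟩)
        · simp only [Finset.mem_product, Finset.mem_filter, Finset.mem_powerset]
          refine ⟨ht.1 ha, (Finset.erase_subset _ _).trans ht.1, ?_⟩
          rw [Finset.card_erase_of_mem ha]
          omega
        · exact Finset.insert_erase ha
    calc _ ≤ _ := Finset.card_le_card hsub
      _ ≤ _ := Finset.card_union_le _ _
      _ ≤ (s.powerset.filter (·.card ≤ d)).card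
          + s.card * (s.powerset.filter (·.card ≤ d)).card := by
        gcongr
        exact Finset.card_image_le.trans (Finset.card_product _ _).le
      _ ≤ (s.card + 1) ^ d + s.card * (s.card + 1) ^ d := by gcongr
      _ = (s.card + 1) ^ (d + 1) := by ring

theorem card_updates_le (T d : ℕ) : (updates T d).card ≤ (4 * T + 1) ^ d := by
  refine (card_powerset_filter_card_le _ d).trans (le_of_eq ?_)
  simp [Finset.card_product, mul_comm]

theorem updates_nonempty (T d : ℕ) : (updates T d).Nonempty :=
  ⟨∅, by simp [updates]⟩

/-- Every hypothesis in the ball is followed, up to `α`, by an expert with few updates, except at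
few times. -/
theorem exists_expert {ℋ : Type*} [NormedAddCommGroup ℋ] [InnerProductSpace ℝ ℋ]
    {x : ℕ → Bool → ℋ} {a : ℋ} {R Λ α : ℝ} (hx : ∀ s b, ‖x s b‖ ≤ R) (ha : ‖a‖ ≤ Λ) (hα : 0 < α)
    (T : ℕ) :
    ∃ S ∈ updates T ⌊(Λ * R / α) ^ 2⌋₊, ∃ B : Finset ℕ, (B.card : ℝ) ≤ (Λ * R / α) ^ 2 ∧
      ∀ t < T, t ∉ B → ∀ b,
        |⟪weight (α / R ^ 2) S t (fun i b => x i b), x t b⟫ - ⟪a, x t b⟫| ≤ α := by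
  obtain ⟨S, hS, hpot, hmis⟩ := exists_perceptron hx ha hα T
  have hcard : (S.card : ℝ) ≤ (Λ * R / α) ^ 2 := by
    rw [div_pow, le_div_iff₀ (by positivity)]
    have : 0 ≤ R ^ 2 * ‖weight (α / R ^ 2) S T (fun i b => x i b) - a‖ ^ 2 := by positivity
    linarith [mul_pow Λ R 2]
  refine ⟨S, ?_, S.image Prod.fst, ?_, ?_⟩
  · simp only [updates, Finset.mem_filter, Finset.mem_powerset]
    refine ⟨fun e he => ?_, Nat.le_floor hcard⟩
    simpa using hS e he
  · exact le_trans (by exact_mod_cast Finset.card_image_le) hcard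
  · intro t ht htB b
    by_contra hlt
    rw [← inner_sub_left, not_le] at hlt
    obtain ⟨e, he, het⟩ := hmis t ht ⟨b, hlt⟩
    exact htB (Finset.mem_image.2 ⟨e, he, het⟩)

/-! ### Chaining with clipped links. -/

/-- The truncation of `x` to `[-c, c]`. -/
def clip (c x : ℝ) : ℝ := max (-c) (min c x)

theorem abs_clip_le {c : ℝ} (hc : 0 ≤ c) (x : ℝ) : |clip c x| ≤ c :=
  abs_le.2 ⟨le_max_left _ _, max_le (by linarith) (min_le_left _ _)⟩

theorem clip_of_abs_le {c x : ℝ} (h : |x| ≤ c) : clip c x = x := by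
  obtain ⟨h1, h2⟩ := abs_le.1 h
  rw [clip, min_eq_right h2, max_eq_right h1]

@[fun_prop]
theorem measurable_clip (c : ℝ) : Measurable (clip c) := by
  unfold clip; fun_prop

/-- Chaining along levels of precision `e k`, some of which (those in `B`) may fail. -/
theorem abs_sub_sum_clip_le {f : ℝ} {h e : ℕ → ℝ} (he : ∀ k, 0 ≤ e k)
    (he4 : ∀ k, e k = 4 * e (k + 1)) (B : ℕ → Prop) [DecidablePred B]
    (h0 : |f - h 0| ≤ e 0) (hh : h 0 = 0) (hB : ∀ k, ¬ B (k + 1) → |f - h (k + 1)| ≤ e (k + 1))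
    (K : ℕ) :
    |f - ∑ k ∈ Finset.range K, clip (5 / 4 * e k) (h (k + 1) - h k)|
      ≤ e K + 11 * ∑ k ∈ Finset.range K, if B (k + 1) then e (k + 1) else 0 := by
  have hnn : ∀ K, 0 ≤ ∑ k ∈ Finset.range K, if B (k + 1) then e (k + 1) else 0 := fun K =>
    Finset.sum_nonneg fun k _ => by split_ifs <;> simp [he]
  -- Either no level has failed and the links telescope, or the error is bounded with a reserve `5/3
  -- e K = 5/4 (e K + e (K+1) + ...)` paying for all later clipped links. A first failure costs `e K
  -- + 5/4 e K = 9 e (K+1)`, which with the reserve `5/3 e (K+1)` stays below `11 e (K+1)`. The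
  -- threshold `5/4 e k = e k + e (k+1)` is inactive between two accurate levels.
  suffices key : ((∑ k ∈ Finset.range K, clip (5 / 4 * e k) (h (k + 1) - h k)) = h K ∧
        |f - h K| ≤ e K) ∨
      |f - ∑ k ∈ Finset.range K, clip (5 / 4 * e k) (h (k + 1) - h k)| + 5 / 3 * e K
        ≤ 11 * ∑ k ∈ Finset.range K, if B (k + 1) then e (k + 1) else 0 by
    rcases key with ⟨h1, h2⟩ | h1
    · rw [h1]; linarith [hnn K]
    · linarith [he K]
  induction K with
  | zero => left; simp [hh]; simpa [hh] using h0
  | succ K ih =>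
    rw [Finset.sum_range_succ, Finset.sum_range_succ]
    have hc := abs_clip_le (c := 5 / 4 * e K) (by linarith [he K]) (h (K + 1) - h K)
    have h4 := he4 K
    have h1 := he (K + 1)
    rcases ih with ⟨ih1, ih2⟩ | ih
    · by_cases hb : B (K + 1)
      · right
        rw [if_pos hb, ih1, ← sub_sub]
        have := abs_sub (f - h K) (clip (5 / 4 * e K) (h (K + 1) - h K))
        linarith [hnn K]
      · left
        have hg := hB K hb
        refine ⟨?_, hg⟩
        rw [ih1, clip_of_abs_le]
        · ring
        · have := abs_sub (f - h K) (f - h (K + 1))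
          rw [sub_sub_sub_cancel_left] at this
          linarith
    · right
      have := abs_sub (f - ∑ k ∈ Finset.range K, clip (5 / 4 * e k) (h (k + 1) - h k))
        (clip (5 / 4 * e K) (h (K + 1) - h K))
      rw [sub_sub] at this
      split_ifs <;> linarith

/-! ### A bounded Lipschitz version of the power loss. -/

/-- The `p`-th power truncated to `[0, M]`. -/
noncomputable def truncPow (p M v : ℝ) : ℝ := min ((min |v| M) ^ p) M

theorem truncPow_nonneg {p M : ℝ} (hM : 0 ≤ M) (v : ℝ) : 0 ≤ truncPow p M v :=
  le_min (Real.rpow_nonneg (le_min (abs_nonneg v) hM) p) hM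

theorem truncPow_le {p M : ℝ} (v : ℝ) : truncPow p M v ≤ M := min_le_right _ _

theorem truncPow_of_le {p M v : ℝ} (h1 : |v| ≤ M) (h2 : |v| ^ p ≤ M) : truncPow p M v = |v| ^ p := by
  rw [truncPow, min_eq_left h1, min_eq_left h2]

@[fun_prop]
theorem measurable_truncPow (p M : ℝ) : Measurable (truncPow p M) := by
  unfold truncPow
  fun_prop

theorem rpow_sub_rpow_le {p M x y : ℝ} (hp : 1 ≤ p) (hx : 0 ≤ x) (hxM : x ≤ M) (hy : 0 ≤ y)
    (hyM : y ≤ M) : |x ^ p - y ^ p| ≤ p * M ^ (p - 1) * |x - y| := by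
  have hder : ∀ z ∈ Set.Icc (0 : ℝ) M,
      HasDerivWithinAt (fun z : ℝ => z ^ p) (p * z ^ (p - 1)) (Set.Icc 0 M) z :=
    fun z _ => (Real.hasDerivAt_rpow_const (Or.inr hp)).hasDerivWithinAt
  have hbd : ∀ z ∈ Set.Icc (0 : ℝ) M, ‖p * z ^ (p - 1)‖ ≤ p * M ^ (p - 1) := by
    intro z hz
    have h0 : 0 ≤ z ^ (p - 1) := Real.rpow_nonneg hz.1 _
    rw [Real.norm_of_nonneg (by positivity)]
    gcongr
    · exact hz.1
    · exact hz.2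
  have := (convex_Icc (0 : ℝ) M).norm_image_sub_le_of_norm_hasDerivWithin_le hder hbd
    (Set.mem_Icc.2 ⟨hy, hyM⟩) (Set.mem_Icc.2 ⟨hx, hxM⟩)
  simpa using this

theorem abs_truncPow_sub_le {p M : ℝ} (hp : 1 ≤ p) (hM : 0 ≤ M) (u v : ℝ) :
    |truncPow p M u - truncPow p M v| ≤ p * M ^ (p - 1) * |u - v| := by
  have h1 : |truncPow p M u - truncPow p M v| ≤ |(min |u| M) ^ p - (min |v| M) ^ p| :=
    (abs_min_sub_min_le_max _ _ _ _).trans (by simp)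
  have h2 : |min |u| M - min |v| M| ≤ |u - v| :=
    (abs_min_sub_min_le_max _ _ _ _).trans (by simpa using abs_abs_sub_abs_le u v)
  refine h1.trans ((rpow_sub_rpow_le hp (le_min (abs_nonneg _) hM) (min_le_right _ _)
    (le_min (abs_nonneg _) hM) (min_le_right _ _)).trans ?_)
  have : 0 ≤ M ^ (p - 1) := Real.rpow_nonneg hM _
  gcongr

/-! ### Tangent sequences and exponential moments of walks. -/

section Tangent

variable {𝒵 : Type*} [MeasurableSpace 𝒵]

theorem measurable_init {t : ℕ} : Measurable (fun z : Fin (t + 1) → 𝒵 => (Fin.init z : Fin t → 𝒵)) :=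
  measurable_pi_lambda _ fun i => measurable_pi_apply i.castSucc

theorem measurable_snoc {t : ℕ} :
    Measurable (fun p : (Fin t → 𝒵) × 𝒵 => (Fin.snoc p.1 p.2 : Fin (t + 1) → 𝒵)) := by
  refine measurable_pi_lambda _ fun i => ?_
  refine Fin.lastCases ?_ (fun j => ?_) i
  · simpa using measurable_snd
  · simpa [Function.comp_def] using
      (measurable_pi_apply (X := fun _ => 𝒵) j).comp (measurable_fst (β := 𝒵))

/-- The law of a tangent sequence: given the path `z`, the coordinates are independent and the
coordinate `t` has the law `κ t` of `Z t` given the path before `t`. -/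
noncomputable def tangent (κ : (t : ℕ) → Kernel (Fin t → 𝒵) 𝒵) :
    (t : ℕ) → Kernel (Fin t → 𝒵) (Fin t → 𝒵)
  | 0 => Kernel.id
  | t + 1 => ((tangent κ t ×ₖ κ t).comap Fin.init measurable_init).map
      (fun p => (Fin.snoc p.1 p.2 : Fin (t + 1) → 𝒵))

variable {κ : (t : ℕ) → Kernel (Fin t → 𝒵) 𝒵}

theorem isMarkovKernel_tangent {T : ℕ} (hκ : ∀ t < T, IsMarkovKernel (κ t)) :
    IsMarkovKernel (tangent κ T) := by
  induction T with
  | zero => unfold tangent; infer_instance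
  | succ T ih =>
    have := ih fun t ht => hκ t (ht.trans (Nat.lt_succ_self T))
    have := hκ T (Nat.lt_succ_self T)
    unfold tangent
    exact Kernel.IsMarkovKernel.map _ measurable_snoc

theorem tangent_succ_apply {T : ℕ} (hκ : ∀ t < T + 1, IsMarkovKernel (κ t)) (z : Fin (T + 1) → 𝒵) :
    tangent κ (T + 1) z = ((tangent κ T (Fin.init z)).prod (κ T (Fin.init z))).map
      (fun p => (Fin.snoc p.1 p.2 : Fin (T + 1) → 𝒵)) := by
  have := isMarkovKernel_tangent fun t (ht : t < T) => hκ t (ht.trans (Nat.lt_succ_self T))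
  have := hκ T (Nat.lt_succ_self T)
  rw [tangent, Kernel.map_apply _ measurable_snoc, Kernel.comap_apply, Kernel.prod_apply]

theorem lintegral_tangent_snoc {T : ℕ} (hκ : ∀ t < T + 1, IsMarkovKernel (κ t)) (z : Fin T → 𝒵) (x : 𝒵)
    {F : (Fin (T + 1) → 𝒵) → ENNReal} (hF : Measurable F) :
    ∫⁻ z', F z' ∂(tangent κ (T + 1) (Fin.snoc z x)) =
      ∫⁻ z', ∫⁻ x', F (Fin.snoc z' x') ∂(κ T z) ∂(tangent κ T z) := by
  have := isMarkovKernel_tangent fun t (ht : t < T) => hκ t (ht.trans (Nat.lt_succ_self T))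
  have := hκ T (Nat.lt_succ_self T)
  have h : Fin.init (Fin.snoc z x : Fin (T + 1) → 𝒵) = z := Fin.init_snoc (α := fun _ => 𝒵) x z
  rw [tangent_succ_apply hκ, h, lintegral_map hF measurable_snoc]
  exact lintegral_prod _ (hF.comp measurable_snoc).aemeasurable

/-- These marginals turn the mean over the tangent sequence of a loss at time `t` into `condMean` at
`t`. -/
theorem tangent_map_apply {T : ℕ} (hκ : ∀ t < T, IsMarkovKernel (κ t)) (zz : ℕ → 𝒵) {t : ℕ}
    (ht : t < T) :
    (tangent κ T (fun i => zz i)).map (fun z' => z' ⟨t, ht⟩) = κ t (fun i => zz i) := by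
  induction T with
  | zero => exact absurd ht (Nat.not_lt_zero t)
  | succ T ih =>
    have hκ' := fun t (ht : t < T) => hκ t (ht.trans (Nat.lt_succ_self T))
    have := isMarkovKernel_tangent hκ'
    have := hκ T (Nat.lt_succ_self T)
    rw [tangent_succ_apply hκ, Measure.map_map (measurable_pi_apply _) measurable_snoc]
    have hinit : (Fin.init fun i : Fin (T + 1) => zz i) = fun i : Fin T => zz i := rfl
    rw [hinit]
    rcases Nat.lt_succ_iff_lt_or_eq.1 ht with h | rfl
    · rw [← ih hκ' h]
      have : (fun z' : Fin (T + 1) → 𝒵 => z' ⟨t, ht⟩) ∘ (fun p : (Fin T → 𝒵) × 𝒵 => Fin.snoc p.1 p.2)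
          = (fun z' : Fin T → 𝒵 => z' ⟨t, h⟩) ∘ Prod.fst := by
        funext p
        exact Fin.snoc_castSucc (α := fun _ => 𝒵) p.2 p.1 ⟨t, h⟩
      rw [this, ← Measure.map_map (measurable_pi_apply _) measurable_fst, Measure.map_fst_prod]
      simp
    · have : (fun z' : Fin (t + 1) → 𝒵 => z' ⟨t, ht⟩) ∘ (fun p : (Fin t → 𝒵) × 𝒵 => Fin.snoc p.1 p.2)
          = Prod.snd := by
        funext p
        exact Fin.snoc_last (α := fun _ => 𝒵) p.2 p.1
      rw [this, Measure.map_snd_prod]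
      simp

/-- The weighted sum of the differences between the increments along the tangent sequence `z'` and
along the path `z`; the increments at time `t` depend on both sequences before `t`. -/
noncomputable def walk (q : ℕ → ℝ) (D : (t : ℕ) → (Fin t → 𝒵) → (Fin t → 𝒵) → 𝒵 → ℝ) :
    (t : ℕ) → (Fin t → 𝒵) → (Fin t → 𝒵) → ℝ
  | 0 => fun _ _ => 0
  | t + 1 => fun z z' => walk q D t (Fin.init z) (Fin.init z') +
      q t * (D t (Fin.init z) (Fin.init z') (z' (Fin.last t))
        - D t (Fin.init z) (Fin.init z') (z (Fin.last t)))

omit [MeasurableSpace 𝒵] in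
theorem walk_eq_sum (q : ℕ → ℝ) (D : (t : ℕ) → (Fin t → 𝒵) → (Fin t → 𝒵) → 𝒵 → ℝ)
    (zz zz' : ℕ → 𝒵) (T : ℕ) :
    walk q D T (fun i => zz i) (fun i => zz' i) = ∑ t ∈ Finset.range T,
      q t * (D t (fun i => zz i) (fun i => zz' i) (zz' t)
        - D t (fun i => zz i) (fun i => zz' i) (zz t)) := by
  induction T with
  | zero => rfl
  | succ T ih =>
    rw [Finset.sum_range_succ, ← ih]
    rfl

omit [MeasurableSpace 𝒵] in
theorem walk_snoc (q : ℕ → ℝ) (D : (t : ℕ) → (Fin t → 𝒵) → (Fin t → 𝒵) → 𝒵 → ℝ) {t : ℕ}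
    (z z' : Fin t → 𝒵) (x x' : 𝒵) :
    walk q D (t + 1) (Fin.snoc z x) (Fin.snoc z' x')
      = walk q D t z z' + q t * (D t z z' x' - D t z z' x) := by
  have h : ∀ (z : Fin t → 𝒵) (x : 𝒵), Fin.init (Fin.snoc z x : Fin (t + 1) → 𝒵) = z :=
    fun z x => Fin.init_snoc (α := fun _ => 𝒵) x z
  have h' : ∀ (z : Fin t → 𝒵) (x : 𝒵), (Fin.snoc z x : Fin (t + 1) → 𝒵) (Fin.last t) = x :=
    fun z x => Fin.snoc_last (α := fun _ => 𝒵) x z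
  simp only [walk, h, h']

variable {D : (t : ℕ) → (Fin t → 𝒵) → (Fin t → 𝒵) → 𝒵 → ℝ}

theorem measurable_walk (q : ℕ → ℝ)
    (hD : ∀ t, Measurable fun x : ((Fin t → 𝒵) × (Fin t → 𝒵)) × 𝒵 => D t x.1.1 x.1.2 x.2) (T : ℕ) :
    Measurable fun x : (Fin T → 𝒵) × (Fin T → 𝒵) => walk q D T x.1 x.2 := by
  induction T with
  | zero => exact measurable_const
  | succ T ih =>
    have h1 : Measurable fun x : (Fin (T + 1) → 𝒵) × (Fin (T + 1) → 𝒵) =>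
        ((Fin.init x.1 : Fin T → 𝒵), (Fin.init x.2 : Fin T → 𝒵)) :=
      (measurable_init.comp measurable_fst).prodMk (measurable_init.comp measurable_snd)
    have h2 : Measurable fun x : (Fin (T + 1) → 𝒵) × (Fin (T + 1) → 𝒵) => x.1 (Fin.last T) :=
      (measurable_pi_apply _).comp measurable_fst
    have h3 : Measurable fun x : (Fin (T + 1) → 𝒵) × (Fin (T + 1) → 𝒵) => x.2 (Fin.last T) :=
      (measurable_pi_apply _).comp measurable_snd
    exact (ih.comp h1).add ((((hD T).comp (h1.prodMk h3)).sub ((hD T).comp (h1.prodMk h2))).const_mul _)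

/-- Centring at the mean factors the double integral, and Hoeffding's lemma gives `exp(s² c² / 2)`
for each factor. -/
theorem lintegral_exp_mul_le {α : Type*} [MeasurableSpace α] {ν : Measure α} [IsProbabilityMeasure ν]
    {g : α → ℝ} (hg : Measurable g) {c : ℝ} (hc : ∀ x, |g x| ≤ c) (s : ℝ) :
    ∫⁻ x, ∫⁻ y, ENNReal.ofReal (Real.exp (s * (g y - g x))) ∂ν ∂ν
      ≤ ENNReal.ofReal (Real.exp (s ^ 2 * c ^ 2)) := by
  have hsub : HasSubgaussianMGF (fun x => g x - ∫ y, g y ∂ν) ((‖c - -c‖₊ / 2) ^ 2) ν :=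
    hasSubgaussianMGF_of_mem_Icc hg.aemeasurable
      (Filter.Eventually.of_forall fun x => Set.mem_Icc.2 (abs_le.1 (hc x)))
  have hc' : (((‖c - -c‖₊ / 2) ^ 2 : NNReal) : ℝ) = c ^ 2 := by
    simp only [NNReal.coe_pow, NNReal.coe_div, coe_nnnorm, Real.norm_eq_abs, NNReal.coe_ofNat]
    rw [div_pow, sq_abs]
    ring
  set m := ∫ y, g y ∂ν
  have h1 : ∀ s : ℝ, ∫⁻ y, ENNReal.ofReal (Real.exp (s * (g y - m))) ∂ν
      ≤ ENNReal.ofReal (Real.exp (s ^ 2 * c ^ 2 / 2)) := by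
    intro s
    rw [← ofReal_integral_eq_lintegral_ofReal (hsub.integrable_exp_mul s)
      (Filter.Eventually.of_forall fun x => (Real.exp_pos _).le)]
    refine ENNReal.ofReal_le_ofReal ((hsub.mgf_le s).trans (le_of_eq ?_))
    rw [hc', mul_comm (c ^ 2)]
  have hmeas : ∀ s : ℝ, Measurable fun y => ENNReal.ofReal (Real.exp (s * (g y - m))) :=
    fun s => by fun_prop
  calc ∫⁻ x, ∫⁻ y, ENNReal.ofReal (Real.exp (s * (g y - g x))) ∂ν ∂ν
      = ∫⁻ x, ENNReal.ofReal (Real.exp (-s * (g x - m))) *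
          ∫⁻ y, ENNReal.ofReal (Real.exp (s * (g y - m))) ∂ν ∂ν := by
        refine lintegral_congr fun x => ?_
        rw [← lintegral_const_mul _ (hmeas s)]
        refine lintegral_congr fun y => ?_
        rw [← ENNReal.ofReal_mul (Real.exp_pos _).le, ← Real.exp_add]
        ring_nf
    _ ≤ ENNReal.ofReal (Real.exp (s ^ 2 * c ^ 2 / 2)) *
          ENNReal.ofReal (Real.exp (s ^ 2 * c ^ 2 / 2)) := by
        rw [lintegral_mul_const _ (hmeas (-s))]
        have := h1 (-s)
        rw [neg_sq] at this
        exact mul_le_mul' this (h1 s)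
    _ = _ := by
        rw [← ENNReal.ofReal_mul (Real.exp_pos _).le, ← Real.exp_add]
        ring_nf

theorem map_past_succ {Ω : Type*} [MeasurableSpace Ω] {μ : Measure Ω} {Z : ℕ → Ω → 𝒵} {T t : ℕ}
    (hZ : ∀ t ≤ T, Measurable (Z t)) (hκ : IsRegularCondLaw μ Z T κ) (ht : t ≤ T) :
    μ.map (past Z (t + 1)) = ((μ.map (past Z t)) ⊗ₘ (κ t)).map
      (fun p => (Fin.snoc p.1 p.2 : Fin (t + 1) → 𝒵)) := by
  have hp : Measurable (past Z t) := measurable_pi_lambda _ fun i => hZ i (i.2.le.trans ht)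
  rw [← (hκ t ht).2, Measure.map_map measurable_snoc (hp.prodMk (hZ t ht))]
  congr 1
  funext ω
  exact (Fin.snoc_init_self (past Z (t + 1) ω)).symm

theorem measurable_past {Ω : Type*} [MeasurableSpace Ω] {Z : ℕ → Ω → 𝒵} {t : ℕ}
    (hZ : ∀ s < t, Measurable (Z s)) : Measurable (past Z t) :=
  measurable_pi_lambda _ fun i => hZ i i.2

/-- The exponential moments of a walk driven by a process and by its tangent sequence. -/
theorem lintegral_exp_walk_le {Ω : Type*} [MeasurableSpace Ω] {μ : Measure Ω}
    [IsProbabilityMeasure μ] {Z : ℕ → Ω → 𝒵} {T : ℕ}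
    (hZ : ∀ t ≤ T, Measurable (Z t)) (hκ : IsRegularCondLaw μ Z T κ) (q : ℕ → ℝ)
    (hD : ∀ t, Measurable fun x : ((Fin t → 𝒵) × (Fin t → 𝒵)) × 𝒵 => D t x.1.1 x.1.2 x.2)
    {c : ℝ} (hc : ∀ t z z' x, |D t z z' x| ≤ c) (s : ℝ) {t : ℕ} (ht : t ≤ T) :
    ∫⁻ z, ∫⁻ z', ENNReal.ofReal (Real.exp (s * walk q D t z z')) ∂(tangent κ t z) ∂(μ.map (past Z t))
      ≤ ENNReal.ofReal (Real.exp (s ^ 2 * c ^ 2 * ∑ i ∈ Finset.range t, q i ^ 2)) := by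
  have hW : ∀ t, Measurable fun x : (Fin t → 𝒵) × (Fin t → 𝒵) =>
      ENNReal.ofReal (Real.exp (s * walk q D t x.1 x.2)) := fun t =>
    (((measurable_walk q hD t).const_mul s).exp).ennreal_ofReal
  have hWz' : ∀ t (z : Fin t → 𝒵), Measurable fun z' : Fin t → 𝒵 =>
      ENNReal.ofReal (Real.exp (s * walk q D t z z')) := fun t z =>
    (hW t).comp measurable_prodMk_left
  induction t with
  | zero =>
    have : IsProbabilityMeasure (μ.map (past Z 0)) :=
      Measure.isProbabilityMeasure_map (measurable_past (by simp)).aemeasurable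
    simp [tangent, walk, Kernel.id_apply]
  | succ t ih =>
    have htT : t ≤ T := (Nat.le_succ t).trans ht
    have hM : ∀ s < t + 1, IsMarkovKernel (κ s) := fun s hs => (hκ s (by omega)).1
    have := isMarkovKernel_tangent hM
    have htan := isMarkovKernel_tangent fun s (hs : s < t) => hM s (by omega)
    have := hM t (Nat.lt_succ_self t)
    have : IsProbabilityMeasure (μ.map (past Z t)) :=
      Measure.isProbabilityMeasure_map
        (measurable_past fun s hs => hZ s (hs.le.trans htT)).aemeasurable
    have hI : Measurable fun z : Fin (t + 1) → 𝒵 => ∫⁻ z', ENNReal.ofReal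
        (Real.exp (s * walk q D (t + 1) z z')) ∂(tangent κ (t + 1) z) :=
      (hW (t + 1)).lintegral_kernel_prod_right'
    have hI' : Measurable fun p : (Fin t → 𝒵) × 𝒵 => ∫⁻ z', ENNReal.ofReal
        (Real.exp (s * walk q D (t + 1) (Fin.snoc p.1 p.2) z'))
          ∂(tangent κ (t + 1) (Fin.snoc p.1 p.2)) := hI.comp measurable_snoc
    rw [map_past_succ hZ hκ htT, lintegral_map hI measurable_snoc, Measure.lintegral_compProd hI']
    have hstep : ∀ z : Fin t → 𝒵, ∫⁻ x, ∫⁻ z', ENNReal.ofReal (Real.exp (s * walk q D (t + 1)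
          (Fin.snoc z x) z')) ∂(tangent κ (t + 1) (Fin.snoc z x)) ∂(κ t z)
        ≤ ENNReal.ofReal (Real.exp (s ^ 2 * c ^ 2 * q t ^ 2)) *
          ∫⁻ z', ENNReal.ofReal (Real.exp (s * walk q D t z z')) ∂(tangent κ t z) := by
      intro z
      have hD1 : ∀ z z', Measurable (D t z z') := fun z z' =>
        (hD t).comp (measurable_prodMk_left (x := (z, z')))
      have hDz : Measurable fun x : (Fin t → 𝒵) × 𝒵 => D t z x.1 x.2 :=
        (hD t).comp ((measurable_const.prodMk measurable_fst).prodMk measurable_snd)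
      have hWz : Measurable fun z' : Fin t → 𝒵 => walk q D t z z' :=
        (measurable_walk q hD t).comp measurable_prodMk_left
      have e1 : ∀ x, ∫⁻ z', ENNReal.ofReal (Real.exp (s * walk q D (t + 1)
          (Fin.snoc z x) z')) ∂(tangent κ (t + 1) (Fin.snoc z x))
          = ∫⁻ z', ∫⁻ x', ENNReal.ofReal (Real.exp (s * walk q D t z z')) *
              ENNReal.ofReal (Real.exp (s * q t * (D t z z' x' - D t z z' x))) ∂(κ t z)
              ∂(tangent κ t z) := by
        intro x
        have hx : Measurable fun z' : Fin (t + 1) → 𝒵 =>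
            ENNReal.ofReal (Real.exp (s * walk q D (t + 1) (Fin.snoc z x) z')) :=
          hWz' (t + 1) (Fin.snoc z x)
        rw [lintegral_tangent_snoc hM z x hx]
        refine lintegral_congr fun z' => lintegral_congr fun x' => ?_
        rw [← ENNReal.ofReal_mul (Real.exp_pos _).le, ← Real.exp_add, walk_snoc, mul_add, mul_assoc]
      simp_rw [e1]
      -- For a fixed past of both sequences, `x` and `x'` are independent with the same law `κ t z`,
      -- and the increment function is the same for both, so the two-point estimate applies.
      rw [lintegral_lintegral_swap]
      · rw [← lintegral_const_mul _ (by fun_prop)]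
        refine lintegral_mono fun z' => ?_
        have h1 : ∀ x, Measurable fun x' =>
            ENNReal.ofReal (Real.exp (s * q t * (D t z z' x' - D t z z' x))) := fun x =>
          ((((hD1 z z').sub_const _).const_mul _).exp).ennreal_ofReal
        have h2 : Measurable fun x : 𝒵 => ∫⁻ x',
            ENNReal.ofReal (Real.exp (s * q t * (D t z z' x' - D t z z' x))) ∂(κ t z) := by
          refine Measurable.lintegral_prod_right'
            (f := fun y : 𝒵 × 𝒵 => ENNReal.ofReal (Real.exp (s * q t * (D t z z' y.2 - D t z z' y.1)))) ?_
          exact (((((hD1 z z').comp measurable_snd).sub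
            ((hD1 z z').comp measurable_fst)).const_mul _).exp).ennreal_ofReal
        simp_rw [lintegral_const_mul _ (h1 _)]
        rw [lintegral_const_mul _ h2, mul_comm]
        gcongr
        refine (lintegral_exp_mul_le (hD1 z z') (hc t z z') (s * q t)).trans (le_of_eq ?_)
        ring_nf
      · refine (Measurable.lintegral_prod_right' (f := fun y : (𝒵 × (Fin t → 𝒵)) × 𝒵 =>
          ENNReal.ofReal (Real.exp (s * walk q D t z y.1.2)) *
              ENNReal.ofReal (Real.exp (s * q t * (D t z y.1.2 y.2 - D t z y.1.2 y.1.1)))) ?_).aemeasurable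
        have a1 : Measurable fun y : (𝒵 × (Fin t → 𝒵)) × 𝒵 => walk q D t z y.1.2 :=
          hWz.comp (measurable_snd.comp measurable_fst)
        have a2 : Measurable fun y : (𝒵 × (Fin t → 𝒵)) × 𝒵 => D t z y.1.2 y.2 :=
          hDz.comp ((measurable_snd.comp measurable_fst).prodMk measurable_snd)
        have a3 : Measurable fun y : (𝒵 × (Fin t → 𝒵)) × 𝒵 => D t z y.1.2 y.1.1 :=
          hDz.comp ((measurable_snd.comp measurable_fst).prodMk (measurable_fst.comp measurable_fst))
        exact ((a1.const_mul s).exp.ennreal_ofReal).mul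
          (((a2.sub a3).const_mul _).exp.ennreal_ofReal)
    refine (lintegral_mono hstep).trans ?_
    rw [lintegral_const_mul _ (hW t).lintegral_kernel_prod_right']
    refine (mul_le_mul' le_rfl (ih htT)).trans (le_of_eq ?_)
    rw [← ENNReal.ofReal_mul (Real.exp_pos _).le, ← Real.exp_add, Finset.sum_range_succ]
    ring_nf

end Tangent

/-! ### An integrable majorant of finitely many walks. -/

section Majorant

variable {𝒵 : Type*} [MeasurableSpace 𝒵] {κ : (t : ℕ) → Kernel (Fin t → 𝒵) 𝒵}

/-- With probability at least `1 - ε`, finitely many walks have a common majorant whose mean given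
the path is of the order of `√(log |I|)`. -/
theorem exists_majorant {Ω : Type*} [MeasurableSpace Ω] {μ : Measure Ω} [IsProbabilityMeasure μ]
    {Z : ℕ → Ω → 𝒵} {T : ℕ} (hZ : ∀ t ≤ T, Measurable (Z t)) (hκ : IsRegularCondLaw μ Z T κ)
    {q : ℕ → ℝ} (hq : 0 < ∑ t ∈ Finset.range T, q t ^ 2) {ι : Type*} {I : Finset ι}
    (hI : I.Nonempty) {D : ι → (t : ℕ) → (Fin t → 𝒵) → (Fin t → 𝒵) → 𝒵 → ℝ}
    (hD : ∀ i t, Measurable fun x : ((Fin t → 𝒵) × (Fin t → 𝒵)) × 𝒵 => D i t x.1.1 x.1.2 x.2)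
    {c : ℝ} (hc0 : 0 < c) (hc : ∀ i t z z' x, |D i t z z' x| ≤ c) {ε : ℝ} (hε : 0 < ε)
    (hε1 : ε < 1) :
    ∃ E : Set Ω, MeasurableSet E ∧ μ Eᶜ ≤ ENNReal.ofReal ε ∧ ∀ ω ∈ E,
      ∃ Y : (Fin T → 𝒵) → ℝ, Integrable Y (tangent κ T (past Z T ω)) ∧
        ∫ z', Y z' ∂(tangent κ T (past Z T ω))
          ≤ 2 * c * √(∑ t ∈ Finset.range T, q t ^ 2) * √(Real.log (I.card / ε)) ∧
        ∀ i ∈ I, ∀ z', walk q (D i) T (past Z T ω) z' ≤ Y z' := by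
  have halg : ∀ N ℓ : ℝ, 0 < N →
      -(ℓ / (c * N) * (2 * c * N * ℓ)) + (ℓ / (c * N)) ^ 2 * c ^ 2 * N ^ 2 = -ℓ ^ 2 := by
    intro N ℓ hN
    field_simp
    ring
  set N := √(∑ t ∈ Finset.range T, q t ^ 2) with hN
  have hN0 : 0 < N := Real.sqrt_pos.2 hq
  have hN2 : ∑ t ∈ Finset.range T, q t ^ 2 = N ^ 2 := (Real.sq_sqrt hq.le).symm
  have hcard : (1 : ℝ) ≤ I.card := by exact_mod_cast hI.card_pos
  have hlog : 0 < Real.log (I.card / ε) := by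
    apply Real.log_pos
    rw [one_lt_div hε]
    linarith
  set ℓ := √(Real.log (I.card / ε)) with hℓ
  have hℓ0 : 0 < ℓ := Real.sqrt_pos.2 hlog
  have hℓ2 : Real.log (I.card / ε) = ℓ ^ 2 := (Real.sq_sqrt hlog.le).symm
  -- These values optimize `-s x + s² c² N²`, which becomes `-ℓ²`; summing over `I` gives `I.card *
  -- exp(-ℓ²) = ε`.
  set x := 2 * c * N * ℓ with hx
  set s := ℓ / (c * N) with hs
  have hs0 : 0 < s := by positivity
  have hZm : Measurable (past Z T) := measurable_past fun t ht => hZ t ht.le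
  have hmk := isMarkovKernel_tangent fun t (ht : t < T) => (hκ t ht.le).1
  set F : (Fin T → 𝒵) → (Fin T → 𝒵) → ℝ := fun z z' =>
    ∑ i ∈ I, Real.exp (s * (walk q (D i) T z z' - x)) with hF
  have hFm : Measurable fun y : (Fin T → 𝒵) × (Fin T → 𝒵) => F y.1 y.2 :=
    Finset.measurable_fun_sum _ fun i _ =>
      (((measurable_walk q (hD i) T).sub_const x).const_mul s).exp
  have hF0 : ∀ z z', 0 ≤ F z z' := fun z z' => Finset.sum_nonneg fun i _ => (Real.exp_pos _).le
  have hJm : Measurable fun z => ∫⁻ z', ENNReal.ofReal (F z z') ∂(tangent κ T z) :=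
    hFm.ennreal_ofReal.lintegral_kernel_prod_right'
  have hmean : ∫⁻ z, ∫⁻ z', ENNReal.ofReal (F z z') ∂(tangent κ T z) ∂(μ.map (past Z T))
      ≤ ENNReal.ofReal ε := by
    have hterm : ∀ i z z', ENNReal.ofReal (Real.exp (s * (walk q (D i) T z z' - x)))
        = ENNReal.ofReal (Real.exp (-(s * x))) *
          ENNReal.ofReal (Real.exp (s * walk q (D i) T z z')) := by
      intro i z z'
      rw [← ENNReal.ofReal_mul (Real.exp_pos _).le, ← Real.exp_add]
      ring_nf
    have hWm : ∀ i, Measurable fun y : (Fin T → 𝒵) × (Fin T → 𝒵) =>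
        ENNReal.ofReal (Real.exp (s * walk q (D i) T y.1 y.2)) := fun i =>
      (((measurable_walk q (hD i) T).const_mul s).exp).ennreal_ofReal
    have hWz : ∀ i z, Measurable fun z' => ENNReal.ofReal (Real.exp (s * walk q (D i) T z z')) :=
      fun i z => (hWm i).comp measurable_prodMk_left
    have hWI : ∀ i, Measurable fun z => ∫⁻ z', ENNReal.ofReal (Real.exp (s * walk q (D i) T z z'))
        ∂(tangent κ T z) := fun i => (hWm i).lintegral_kernel_prod_right'
    calc ∫⁻ z, ∫⁻ z', ENNReal.ofReal (F z z') ∂(tangent κ T z) ∂(μ.map (past Z T))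
        = ∑ i ∈ I, ENNReal.ofReal (Real.exp (-(s * x))) * ∫⁻ z, ∫⁻ z',
            ENNReal.ofReal (Real.exp (s * walk q (D i) T z z'))
              ∂(tangent κ T z) ∂(μ.map (past Z T)) := by
          simp_rw [hF, ENNReal.ofReal_sum_of_nonneg fun i _ => (Real.exp_pos _).le, hterm]
          simp_rw [lintegral_finsetSum I fun i _ => (hWz i _).const_mul _,
            lintegral_const_mul _ (hWz _ _)]
          rw [lintegral_finsetSum I fun i _ => (hWI i).const_mul _]
          simp_rw [lintegral_const_mul _ (hWI _)]
      _ ≤ ∑ i ∈ I, ENNReal.ofReal (Real.exp (-(s * x))) *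
            ENNReal.ofReal (Real.exp (s ^ 2 * c ^ 2 * N ^ 2)) := by
          gcongr with i _
          rw [← hN2]
          exact lintegral_exp_walk_le hZ hκ q (hD i) (hc i) s le_rfl
      _ = ENNReal.ofReal ε := by
          rw [Finset.sum_const, ← ENNReal.ofReal_mul (Real.exp_pos _).le, ← Real.exp_add,
            nsmul_eq_mul, ← ENNReal.ofReal_natCast, ← ENNReal.ofReal_mul (Nat.cast_nonneg _)]
          congr 1
          have hne : (I.card : ℝ) ≠ 0 := by linarith
          rw [hs, hx, halg N ℓ hN0, ← hℓ2, Real.exp_neg, Real.exp_log (div_pos (by linarith) hε),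
            inv_div, mul_div_cancel₀ _ hne]
  -- Markov's inequality is applied in the observed path only; the tangent sequence remains
  -- integrated.
  refine ⟨{ω | ∫⁻ z', ENNReal.ofReal (F (past Z T ω) z') ∂(tangent κ T (past Z T ω)) < 1},
    measurableSet_lt (hJm.comp hZm) measurable_const, ?_, ?_⟩
  · have h := mul_meas_ge_le_lintegral (μ := μ.map (past Z T)) hJm 1
    rw [one_mul, Measure.map_apply hZm (measurableSet_le measurable_const hJm)] at h
    refine le_trans (le_of_eq ?_) (h.trans hmean)
    congr 1
    ext ω
    simp
  · intro ω hω
    set z := past Z T ω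
    have hFz : Measurable (F z) := hFm.comp measurable_prodMk_left
    have hFi : Integrable (F z) (tangent κ T z) := by
      refine ⟨hFz.aestronglyMeasurable, ?_⟩
      rw [hasFiniteIntegral_iff_ofReal (Filter.Eventually.of_forall (hF0 z))]
      exact lt_trans hω ENNReal.one_lt_top
    have hF1 : ∫ z', F z z' ∂(tangent κ T z) ≤ 1 := by
      rw [integral_eq_lintegral_of_nonneg_ae (Filter.Eventually.of_forall (hF0 z))
        hFz.aestronglyMeasurable]
      exact ENNReal.toReal_le_of_le_ofReal zero_le_one (by simpa using hω.le)
    -- From `u ≤ exp u - 1` with `u = s (walk - x)`, this dominates every walk; its mean is at most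
    -- `x` because `F` has mean at most `1`.
    refine ⟨fun z' => x + s⁻¹ * (F z z' - 1), ?_, ?_, ?_⟩
    · exact (integrable_const x).add ((hFi.sub (integrable_const 1)).const_mul _)
    · have hFi' : Integrable (fun z' => s⁻¹ * (F z z' - 1)) (tangent κ T z) :=
        (hFi.sub (integrable_const 1)).const_mul _
      rw [integral_add (integrable_const x) hFi', integral_const x, integral_const_mul s⁻¹,
        integral_sub hFi (integrable_const 1)]
      simp only [integral_const, probReal_univ, smul_eq_mul, one_mul, mul_one]
      have : s⁻¹ * (∫ z', F z z' ∂(tangent κ T z) - 1) ≤ 0 :=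
        mul_nonpos_of_nonneg_of_nonpos (by positivity) (by linarith)
      linarith
    · intro i hi z'
      have h1 : Real.exp (s * (walk q (D i) T z z' - x)) ≤ F z z' :=
        Finset.single_le_sum (f := fun i => Real.exp (s * (walk q (D i) T z z' - x)))
          (fun i _ => (Real.exp_pos _).le) hi
      have h2 := Real.add_one_le_exp (s * (walk q (D i) T z z' - x))
      have h3 : walk q (D i) T z z' - x ≤ s⁻¹ * (F z z' - 1) := by
        rw [inv_mul_eq_div, le_div_iff₀ hs0]
        linarith
      linarith

end Majorant

/-! ### The chain of expert losses. -/

section Experts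

variable {𝒳 : Type*} {ℋ : Type*} [NormedAddCommGroup ℋ] [InnerProductSpace ℝ ℋ]

/-- The truncated loss at `x` of the expert with step `η` and updates `S`, given the past of two
samples. -/
noncomputable def expertLoss (Ψ : 𝒳 → ℋ) (p M η : ℝ) (S : Finset (ℕ × Bool × Bool)) (t : ℕ)
    (z z' : Fin t → 𝒳 × ℝ) (x : 𝒳 × ℝ) : ℝ :=
  truncPow p M (⟪weight η S t (fun i b => Ψ (cond b (z i) (z' i)).1), Ψ x.1⟫ - x.2)

theorem measurable_expertLoss [MeasurableSpace 𝒳] {Ψ : 𝒳 → ℋ} (hΨ : StronglyMeasurable Ψ)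
    (p M η : ℝ) (S : Finset (ℕ × Bool × Bool)) (t : ℕ) :
    Measurable fun x : ((Fin t → 𝒳 × ℝ) × (Fin t → 𝒳 × ℝ)) × (𝒳 × ℝ) =>
      expertLoss Ψ p M η S t x.1.1 x.1.2 x.2 := by
  have hw : StronglyMeasurable fun x : ((Fin t → 𝒳 × ℝ) × (Fin t → 𝒳 × ℝ)) × (𝒳 × ℝ) =>
      weight η S t (fun i b => Ψ (cond b (x.1.1 i) (x.1.2 i)).1) := by
    unfold weight
    refine Finset.stronglyMeasurable_fun_sum S fun e _ => ?_
    by_cases h : e.1 < t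
    · simp only [dif_pos h]
      refine StronglyMeasurable.const_smul (hΨ.comp_measurable ?_) _
      cases e.2.1
      · simp only [Bool.cond_false]; fun_prop
      · simp only [Bool.cond_true]; fun_prop
    · simp only [dif_neg h]
      exact stronglyMeasurable_const
  have hx : StronglyMeasurable fun x : ((Fin t → 𝒳 × ℝ) × (Fin t → 𝒳 × ℝ)) × (𝒳 × ℝ) =>
      Ψ x.2.1 := hΨ.comp_measurable (by fun_prop)
  exact (measurable_truncPow p M).comp ((hw.inner hx).measurable.sub (by fun_prop))

/-- The precision of the level `k` of the chain. -/
noncomputable def precision (M : ℝ) (k : ℕ) : ℝ := M / 4 ^ k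

/-- The loss of an expert of level `k`; the level `0` predicts the loss `0`. -/
noncomputable def levelLoss (Ψ : 𝒳 → ℋ) (p M R : ℝ) (k : ℕ) (S : Finset (ℕ × Bool × Bool)) (t : ℕ)
    (z z' : Fin t → 𝒳 × ℝ) (x : 𝒳 × ℝ) : ℝ :=
  if k = 0 then 0
  else expertLoss Ψ p M (precision M k / (p * M ^ (p - 1)) / R ^ 2) S t z z' x

/-- The link of the chain between the levels `k` and `k + 1`. -/
noncomputable def link (Ψ : 𝒳 → ℋ) (p M R : ℝ) (k : ℕ)
    (S : Finset (ℕ × Bool × Bool) × Finset (ℕ × Bool × Bool)) (t : ℕ)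
    (z z' : Fin t → 𝒳 × ℝ) (x : 𝒳 × ℝ) : ℝ :=
  clip (5 / 4 * precision M k)
    (levelLoss Ψ p M R (k + 1) S.2 t z z' x - levelLoss Ψ p M R k S.1 t z z' x)

theorem measurable_levelLoss [MeasurableSpace 𝒳] {Ψ : 𝒳 → ℋ} (hΨ : StronglyMeasurable Ψ)
    (p M R : ℝ) (k : ℕ) (S : Finset (ℕ × Bool × Bool)) (t : ℕ) :
    Measurable fun x : ((Fin t → 𝒳 × ℝ) × (Fin t → 𝒳 × ℝ)) × (𝒳 × ℝ) =>
      levelLoss Ψ p M R k S t x.1.1 x.1.2 x.2 := by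
  unfold levelLoss
  split_ifs
  · exact measurable_const
  · exact measurable_expertLoss hΨ p M _ S t

theorem measurable_link [MeasurableSpace 𝒳] {Ψ : 𝒳 → ℋ} (hΨ : StronglyMeasurable Ψ) (p M R : ℝ)
    (k : ℕ) (S : Finset (ℕ × Bool × Bool) × Finset (ℕ × Bool × Bool)) (t : ℕ) :
    Measurable fun x : ((Fin t → 𝒳 × ℝ) × (Fin t → 𝒳 × ℝ)) × (𝒳 × ℝ) =>
      link Ψ p M R k S t x.1.1 x.1.2 x.2 :=
  (measurable_clip _).comp
    ((measurable_levelLoss hΨ p M R _ _ t).sub (measurable_levelLoss hΨ p M R _ _ t))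

theorem precision_eq (M : ℝ) (k : ℕ) : precision M k = 4 * precision M (k + 1) := by
  unfold precision; rw [pow_succ]; field_simp

/-- The largest number of updates of an expert of level `k`, for `A = Λ R p M ^ (p - 1)`. -/
noncomputable def levelSize (M A : ℝ) (k : ℕ) : ℕ := ⌊(A / precision M k) ^ 2⌋₊

/-- Cauchy–Schwarz against the indicator of `B`. It converts the number of update times of an expert
into a cost proportional to the `ℓ²` norm of the weights. -/
theorem sum_abs_mul_le {T : ℕ} (q : ℕ → ℝ) (B : Finset ℕ) :
    ∑ t ∈ Finset.range T, (if t ∈ B then |q t| else 0)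
      ≤ √(∑ t ∈ Finset.range T, q t ^ 2) * √B.card := by
  rw [← Real.sqrt_mul (Finset.sum_nonneg fun t _ => sq_nonneg _)]
  apply Real.le_sqrt_of_sq_le
  have h := Finset.sum_mul_sq_le_sq_mul_sq (Finset.range T) (fun t => |q t|)
    (fun t => if t ∈ B then (1 : ℝ) else 0)
  simp only [mul_ite, mul_one, mul_zero, sq_abs, ite_pow, one_pow, ne_eq, OfNat.ofNat_ne_zero,
    not_false_eq_true, zero_pow] at h
  refine h.trans ?_
  gcongr
  rw [← Finset.sum_filter]
  simp only [Finset.sum_const, nsmul_eq_mul, mul_one]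
  exact_mod_cast Finset.card_le_card fun t ht => (Finset.mem_filter.1 ht).2

/-- Clipped chaining is applied at each time on both samples. At level `k` there are at most `(A /
e_k)²` failures, each costing `O(e_k)`; by Cauchy–Schwarz `e_k` cancels and every level loses the
same multiple of `A ‖q‖₂`. -/
theorem exists_chain {Ψ : 𝒳 → ℋ} {p M R Λ : ℝ} (hp : 1 ≤ p) (hM : 0 < M) (hΨ : ∀ x, ‖Ψ x‖ ≤ R)
    {a : ℋ} (ha : ‖a‖ ≤ Λ) {T : ℕ} {zz zz' : ℕ → 𝒳 × ℝ}
    (h1 : ∀ t < T, |⟪a, Ψ (zz t).1⟫ - (zz t).2| ≤ M ∧ powerLoss Ψ p a (zz t) ≤ M)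
    (h2 : ∀ t < T, |⟪a, Ψ (zz' t).1⟫ - (zz' t).2| ≤ M ∧ powerLoss Ψ p a (zz' t) ≤ M)
    (q : ℕ → ℝ) (K : ℕ) :
    ∃ S : ℕ → Finset (ℕ × Bool × Bool),
      (∀ k, S k ∈ updates T (levelSize M (Λ * R * (p * M ^ (p - 1))) k)) ∧
      ∑ t ∈ Finset.range T, q t * (powerLoss Ψ p a (zz' t) - powerLoss Ψ p a (zz t))
        ≤ ∑ k ∈ Finset.range K, walk q (link Ψ p M R k (S k, S (k + 1))) T (fun i => zz i)
            (fun i => zz' i)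
          + (2 * precision M K * √T + 22 * K * (Λ * R * (p * M ^ (p - 1))))
            * √(∑ t ∈ Finset.range T, q t ^ 2) := by
  set L := p * M ^ (p - 1) with hL
  have hL0 : 0 < L := mul_pos (by linarith) (Real.rpow_pos_of_pos hM _)
  set A := Λ * R * L with hA
  have hA0 : 0 ≤ A := mul_nonneg (mul_nonneg ((norm_nonneg _).trans ha)
    ((norm_nonneg _).trans (hΨ (zz 0).1))) hL0.le
  have he0 : ∀ k, 0 < precision M k := fun k => by unfold precision; positivity
  have hex : ∀ k, Λ * R / (precision M k / L) = A / precision M k := fun k => by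
    have := he0 k
    rw [hA]; field_simp
  -- One perceptron reads both samples, so it is accurate on both at once. Its margin is the
  -- precision divided by the Lipschitz constant `L` of the truncated loss.
  have hexp := fun k => exists_expert (x := fun s b => Ψ (cond b (zz s) (zz' s)).1)
    (fun s b => hΨ _) ha (div_pos (he0 k) hL0) T
  simp only [hex] at hexp
  choose S hS B hB hSB using hexp
  refine ⟨S, hS, ?_⟩
  set N := √(∑ t ∈ Finset.range T, q t ^ 2) with hN
  -- the loss of the hypothesis is close to the sum of the links, on both samples
  have happrox : ∀ t < T, ∀ b : Bool,
      |powerLoss Ψ p a (cond b (zz t) (zz' t)) - ∑ k ∈ Finset.range K,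
          link Ψ p M R k (S k, S (k + 1)) t (fun i => zz i) (fun i => zz' i) (cond b (zz t) (zz' t))|
        ≤ precision M K +
          11 * ∑ k ∈ Finset.range K, if t ∈ B (k + 1) then precision M (k + 1) else 0 := by
    intro t ht b
    have hb : |⟪a, Ψ (cond b (zz t) (zz' t)).1⟫ - (cond b (zz t) (zz' t)).2| ≤ M ∧
        powerLoss Ψ p a (cond b (zz t) (zz' t)) ≤ M := by
      cases b
      · exact h2 t ht
      · exact h1 t ht
    have htr : powerLoss Ψ p a (cond b (zz t) (zz' t)) =
        truncPow p M (⟪a, Ψ (cond b (zz t) (zz' t)).1⟫ - (cond b (zz t) (zz' t)).2) :=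
      (truncPow_of_le hb.1 hb.2).symm
    refine abs_sub_sum_clip_le (h := fun k => levelLoss Ψ p M R k (S k) t (fun i => zz i)
      (fun i => zz' i) (cond b (zz t) (zz' t))) (fun k => (he0 k).le) (precision_eq M)
      (fun k => t ∈ B k) ?_ (if_pos rfl) ?_ K
    · simp only [levelLoss, if_true, sub_zero, precision, pow_zero, div_one]
      rw [htr, abs_of_nonneg (truncPow_nonneg hM.le _)]
      exact truncPow_le _
    · intro k hk
      simp only [levelLoss, Nat.add_eq_zero_iff, one_ne_zero, and_false, if_false, expertLoss]
      rw [htr]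
      refine (abs_truncPow_sub_le hp hM.le _ _).trans ?_
      have := hSB (k + 1) t ht hk b
      rw [abs_sub_comm, sub_sub_sub_cancel_right]
      calc p * M ^ (p - 1) * _ ≤ L * (precision M (k + 1) / L) := by
            rw [← hL]
            exact mul_le_mul_of_nonneg_left this hL0.le
        _ = precision M (k + 1) := by field_simp
  have hterm : ∀ t ∈ Finset.range T,
      q t * (powerLoss Ψ p a (zz' t) - powerLoss Ψ p a (zz t)) ≤
        ∑ k ∈ Finset.range K, q t *
          (link Ψ p M R k (S k, S (k + 1)) t (fun i => zz i) (fun i => zz' i) (zz' t)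
            - link Ψ p M R k (S k, S (k + 1)) t (fun i => zz i) (fun i => zz' i) (zz t))
          + (2 * precision M K * |q t| + 22 * ∑ k ∈ Finset.range K,
              precision M (k + 1) * if t ∈ B (k + 1) then |q t| else 0) := by
    intro t ht
    have ha1 := happrox t (Finset.mem_range.1 ht) true
    have ha2 := happrox t (Finset.mem_range.1 ht) false
    simp only [Bool.cond_true, Bool.cond_false] at ha1 ha2
    rw [← Finset.mul_sum, Finset.sum_sub_distrib]
    set s1 := ∑ k ∈ Finset.range K,
      link Ψ p M R k (S k, S (k + 1)) t (fun i => zz i) (fun i => zz' i) (zz t)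
    set s2 := ∑ k ∈ Finset.range K,
      link Ψ p M R k (S k, S (k + 1)) t (fun i => zz i) (fun i => zz' i) (zz' t)
    have hsum : ∑ k ∈ Finset.range K, precision M (k + 1) * (if t ∈ B (k + 1) then |q t| else 0)
        = |q t| * ∑ k ∈ Finset.range K, if t ∈ B (k + 1) then precision M (k + 1) else 0 := by
      rw [Finset.mul_sum]
      refine Finset.sum_congr rfl fun k _ => ?_
      split_ifs <;> ring
    rw [hsum]
    set σ := ∑ k ∈ Finset.range K, if t ∈ B (k + 1) then precision M (k + 1) else 0
    have h3 : |(powerLoss Ψ p a (zz' t) - powerLoss Ψ p a (zz t)) - (s2 - s1)|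
        ≤ 2 * precision M K + 22 * σ := by
      have := abs_sub (powerLoss Ψ p a (zz' t) - s2) (powerLoss Ψ p a (zz t) - s1)
      rw [sub_sub_sub_comm] at this
      linarith
    have h4 : q t * ((powerLoss Ψ p a (zz' t) - powerLoss Ψ p a (zz t)) - (s2 - s1))
        ≤ |q t| * (2 * precision M K + 22 * σ) := by
      refine (le_abs_self _).trans ?_
      rw [abs_mul]
      gcongr
    linarith
  refine (Finset.sum_le_sum hterm).trans ?_
  simp only [walk_eq_sum]
  rw [Finset.sum_add_distrib, Finset.sum_comm]
  gcongr
  rw [Finset.sum_add_distrib, ← Finset.mul_sum, ← Finset.mul_sum, Finset.sum_comm, add_mul]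
  refine add_le_add ?_ ?_
  · have := sum_abs_mul_le (T := T) q (Finset.range T)
    rw [Finset.card_range, Finset.sum_congr rfl fun t ht => if_pos ht] at this
    rw [mul_assoc (2 * precision M K), mul_comm √(T : ℝ)]
    exact mul_le_mul_of_nonneg_left this (by linarith [he0 K])
  · have : ∀ k ∈ Finset.range K, ∑ t ∈ Finset.range T,
        precision M (k + 1) * (if t ∈ B (k + 1) then |q t| else 0) ≤ A * N := by
      intro k _
      rw [← Finset.mul_sum]
      have hsq : √((B (k + 1)).card : ℝ) ≤ A / precision M (k + 1) :=
        Real.sqrt_le_iff.2 ⟨div_nonneg hA0 (he0 _).le, hB (k + 1)⟩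
      calc precision M (k + 1) * ∑ t ∈ Finset.range T, (if t ∈ B (k + 1) then |q t| else 0)
          ≤ precision M (k + 1) * (N * (A / precision M (k + 1))) := by
            refine mul_le_mul_of_nonneg_left ((sum_abs_mul_le q _).trans ?_) (he0 _).le
            gcongr
        _ = A * N := by
            have := he0 (k + 1)
            field_simp
    have h5 := Finset.sum_le_card_nsmul _ _ _ this
    rw [Finset.card_range, nsmul_eq_mul] at h5
    linarith

end Experts

/-! ### Cardinalities, depth of the chain and constants. -/

/-- Level `k` gets failure probability `δ / 2^(k+1)`, at a cost of at most `(k+1) log(2/δ) ≤ 4^k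
log(2/δ)` in the logarithm. The resulting factor `2^k` is harmless against precisions `M / 4^k`. The
constant is `5` because `1 + 16 ≤ 5²`. -/
theorem sqrt_log_card_le {T d d' k : ℕ} {A e δ : ℝ} (hA : 0 ≤ A) (he : 0 < e) (hδ : 0 < δ)
    (hδ1 : δ < 1) (hd : (d : ℝ) ≤ (A / e) ^ 2) (hd' : (d' : ℝ) ≤ 16 * (A / e) ^ 2) :
    √(Real.log (((updates T d ×ˢ updates T d').card : ℝ) / (δ / 2 ^ (k + 1))))
      ≤ 5 * (A / e) * √(Real.log (4 * T + 1)) + 2 ^ k * √(Real.log (2 / δ)) := by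
  have hcard : ((updates T d ×ˢ updates T d').card : ℝ) ≤ (4 * T + 1 : ℝ) ^ (d + d') := by
    rw [Finset.card_product, pow_add]
    push_cast
    gcongr
    · exact_mod_cast card_updates_le T d
    · exact_mod_cast card_updates_le T d'
  have hpos : (0 : ℝ) < (updates T d ×ˢ updates T d').card := by
    exact_mod_cast ((updates_nonempty T d).product (updates_nonempty T d')).card_pos
  have hT : (1 : ℝ) ≤ 4 * T + 1 := by linarith [Nat.cast_nonneg (α := ℝ) T]
  have hlogT : 0 ≤ Real.log (4 * T + 1) := Real.log_nonneg hT
  have hlogδ : 0 ≤ -Real.log δ := by linarith [Real.log_neg hδ hδ1]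
  have hlogδ2 : Real.log (2 / δ) = Real.log 2 - Real.log δ :=
    Real.log_div two_ne_zero hδ.ne'
  have hlog2 : 0 < Real.log 2 := Real.log_pos one_lt_two
  have h1 : Real.log (((updates T d ×ˢ updates T d').card : ℝ) / (δ / 2 ^ (k + 1)))
      ≤ (d + d') * Real.log (4 * T + 1) + (k + 1) * Real.log (2 / δ) := by
    rw [Real.log_div hpos.ne' (by positivity), Real.log_div hδ.ne' (by positivity), Real.log_pow,
      hlogδ2]
    have h2 := Real.log_le_log hpos hcard
    rw [Real.log_pow] at h2
    push_cast at h2 ⊢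
    nlinarith [mul_nonneg (Nat.cast_nonneg (α := ℝ) k) hlogδ]
  have hk : ((k : ℝ) + 1) ≤ (2 ^ k) ^ 2 := by
    have h3 : k + 1 ≤ 2 ^ k := Nat.lt_two_pow_self
    have h4 : ((k : ℝ) + 1) ≤ 2 ^ k := by exact_mod_cast h3
    have h5 : (1 : ℝ) ≤ 2 ^ k := one_le_pow₀ one_le_two
    nlinarith
  have hlogδ3 : 0 ≤ Real.log (2 / δ) := by rw [hlogδ2]; linarith
  apply Real.sqrt_le_iff.2
  refine ⟨by positivity, h1.trans ?_⟩
  have e1 := Real.sq_sqrt hlogT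
  have e2 := Real.sq_sqrt hlogδ3
  set ℓ := √(Real.log (4 * T + 1))
  set l := √(Real.log (2 / δ))
  rw [← e1, ← e2]
  have hℓ : 0 ≤ ℓ := Real.sqrt_nonneg _
  have hl : 0 ≤ l := Real.sqrt_nonneg _
  have hAe : 0 ≤ A / e := by positivity
  calc ((d : ℝ) + d') * ℓ ^ 2 + (k + 1) * l ^ 2
      ≤ (25 * (A / e) ^ 2) * ℓ ^ 2 + (2 ^ k) ^ 2 * l ^ 2 := by
        gcongr
        nlinarith [sq_nonneg (A / e)]
    _ ≤ (5 * (A / e) * ℓ + 2 ^ k * l) ^ 2 := by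
        have : 0 ≤ 5 * (A / e) * ℓ * (2 ^ k * l) := by positivity
        nlinarith

/-- The sum of the mean majorants of all levels of the chain. -/
theorem sum_majorant_le {T K : ℕ} {M A δ N : ℝ} (hA : 0 ≤ A) (hM : 0 < M) (hδ : 0 < δ)
    (hδ1 : δ < 1) (hN : 0 ≤ N) :
    ∑ k ∈ Finset.range K, 2 * (5 / 4 * precision M k) * N *
        √(Real.log (((updates T (levelSize M A k) ×ˢ updates T (levelSize M A (k + 1))).card : ℝ)
          / (δ / 2 ^ (k + 1))))
      ≤ (25 / 2 * K * A * √(Real.log (4 * T + 1)) + 5 * M * √(Real.log (2 / δ))) * N := by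
  set ℓ := √(Real.log (4 * T + 1))
  set l := √(Real.log (2 / δ))
  have hl : 0 ≤ l := Real.sqrt_nonneg _
  have hterm : ∀ k ∈ Finset.range K, 2 * (5 / 4 * precision M k) * N *
        √(Real.log (((updates T (levelSize M A k) ×ˢ updates T (levelSize M A (k + 1))).card : ℝ)
          / (δ / 2 ^ (k + 1))))
      ≤ 25 / 2 * A * ℓ * N + 5 / 2 * M * l * N * (1 / 2) ^ k := by
    intro k _
    have he : 0 < precision M k := by unfold precision; positivity
    have hd : (levelSize M A k : ℝ) ≤ (A / precision M k) ^ 2 := Nat.floor_le (by positivity)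
    have hd' : (levelSize M A (k + 1) : ℝ) ≤ 16 * (A / precision M k) ^ 2 := by
      refine (Nat.floor_le (by positivity)).trans (le_of_eq ?_)
      have he1 : 0 < precision M (k + 1) := by unfold precision; positivity
      rw [precision_eq M k]
      field_simp
      norm_num
    calc _ ≤ 2 * (5 / 4 * precision M k) * N * (5 * (A / precision M k) * ℓ + 2 ^ k * l) := by
          gcongr
          exact sqrt_log_card_le hA he hδ hδ1 hd hd'
      _ = _ := by
          have h4 : (4 : ℝ) ^ k = 2 ^ k * 2 ^ k := by rw [← mul_pow]; norm_num
          have h2 : (2 : ℝ) ^ k ≠ 0 := by positivity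
          rw [one_div, inv_pow]
          unfold precision
          rw [h4]
          field_simp
          ring
  refine (Finset.sum_le_sum hterm).trans ?_
  rw [Finset.sum_add_distrib, Finset.sum_const, Finset.card_range, nsmul_eq_mul, ← Finset.mul_sum]
  have h := mul_le_mul_of_nonneg_left (sum_geometric_two_le K) (a := 5 / 2 * M * l * N) (by positivity)
  linarith

theorem log_four_mul_add_one_le {T : ℕ} (hT : 2 ≤ T) :
    Real.log (4 * T + 1) ≤ 4 * Real.log T := by
  have hT' : (2 : ℝ) ≤ T := by exact_mod_cast hT
  have h : (4 * T + 1 : ℝ) ≤ (T : ℝ) ^ 4 := by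
    have h3 : (8 : ℝ) ≤ (T : ℝ) ^ 3 := by
      calc (8 : ℝ) = 2 ^ 3 := by norm_num
        _ ≤ _ := by gcongr
    nlinarith
  have := Real.log_le_log (by positivity) h
  rwa [Real.log_pow] at this

theorem log_exp_one_mul_sq {T : ℕ} (hT : 2 ≤ T) :
    Real.log (Real.exp 1 * (T : ℝ) ^ 2) = 1 + 2 * Real.log T := by
  have hT' : (0 : ℝ) < T := by exact_mod_cast (by omega : 0 < T)
  rw [Real.log_mul (Real.exp_pos 1).ne' (by positivity), Real.log_exp, Real.log_pow]
  norm_num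

/-- The depth of the chain. -/
def depth (T : ℕ) : ℕ := Nat.log 2 T + 2

theorem depth_le {T : ℕ} (hT : 2 ≤ T) : (depth T : ℝ) ≤ 2 * Real.log T + 2 := by
  have hT' : (0 : ℝ) < T := by exact_mod_cast (by omega : 0 < T)
  have h : (2 : ℝ) ^ Nat.log 2 T ≤ T := by exact_mod_cast Nat.pow_log_le_self 2 (by omega)
  have h2 := Real.log_le_log (by positivity) h
  rw [Real.log_pow] at h2
  have h3 := Real.log_two_gt_d9
  unfold depth
  push_cast
  have h4 : (0 : ℝ) ≤ Nat.log 2 T := Nat.cast_nonneg _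
  nlinarith

/-- Since `4^depth ≥ 4T²`, the error of the last level is at most `M / (2T)`, small enough to be
absorbed in the confidence term. -/
theorem precision_depth_mul_sqrt_le {T : ℕ} {M : ℝ} (hM : 0 ≤ M) (hT : 2 ≤ T) :
    2 * precision M (depth T) * √T ≤ M / 4 := by
  have hT' : (2 : ℝ) ≤ T := by exact_mod_cast hT
  have h1 : (T : ℝ) ≤ 2 ^ (Nat.log 2 T + 1) := by
    exact_mod_cast (Nat.lt_pow_succ_log_self one_lt_two T).le
  have h2 : (4 * T ^ 2 : ℝ) ≤ 4 ^ depth T := by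
    have : (4 : ℝ) ^ depth T = 4 * (2 ^ (Nat.log 2 T + 1)) ^ 2 := by
      unfold depth
      rw [← pow_mul, show (4 : ℝ) = 2 ^ 2 by norm_num, ← pow_mul, ← pow_add]
      ring_nf
    rw [this]
    gcongr
  have h3 : √(T : ℝ) ≤ T := Real.sqrt_le_iff.2 ⟨by linarith, by nlinarith⟩
  unfold precision
  calc 2 * (M / 4 ^ depth T) * √(T : ℝ) ≤ 2 * (M / (4 * T ^ 2)) * T := by gcongr
    _ = M / (2 * T) := by field_simp; ring
    _ ≤ M / 4 := by gcongr; linarith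

/-- The left side grows like `log^{3/2} T` and the right side like `log² T`. Bounding both
logarithmic roots by multiples of `√(π log T)` leaves a linear inequality in `log T`. -/
theorem depth_mul_le {T : ℕ} {p M : ℝ} (hp : 1 ≤ p) (hM : 1 ≤ M) (hT : 2 ≤ T) :
    depth T * (p * M ^ (p - 1)) * (22 + 25 / 2 * √(Real.log (4 * T + 1))) ≤ 4 * M * constT p M T := by
  have hT' : (2 : ℝ) ≤ T := by exact_mod_cast hT
  have hlog : 0.69 < Real.log T :=
    lt_of_lt_of_le (by linarith [Real.log_two_gt_d9]) (Real.log_le_log two_pos hT')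
  have hpi := Real.pi_gt_three
  set s := √(Real.pi * Real.log T) with hs
  have hs1 : 1 ≤ s := Real.one_le_sqrt.2 (by nlinarith)
  have hℓ : √(Real.log (4 * T + 1)) ≤ 2 * s := by
    apply Real.sqrt_le_iff.2
    refine ⟨by linarith, (log_four_mul_add_one_le hT).trans ?_⟩
    rw [mul_pow, hs, Real.sq_sqrt (by positivity)]
    nlinarith
  have hMp : M ^ (p - 1) ≤ M ^ p := Real.rpow_le_rpow_of_exponent_le hM (by linarith)
  have hMp0 : 0 < M ^ p := Real.rpow_pos_of_pos (by linarith) _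
  have hMp1 : 0 < M ^ (p - 1) := Real.rpow_pos_of_pos (by linarith) _
  have hB : 1 + 2 * Real.log T ≤ (1 + 2 * Real.log T) ^ (3 / 2 : ℝ) := by
    conv_lhs => rw [← Real.rpow_one (1 + 2 * Real.log T)]
    exact Real.rpow_le_rpow_of_exponent_le (by linarith) (by norm_num)
  have h2 : (1 : ℝ) ≤ √2 := Real.one_le_sqrt.2 one_le_two
  have hbr : 1 + 4 * (1 + 2 * Real.log T) ≤ 1 + 4 * √2 * (1 + 2 * Real.log T) ^ (3 / 2 : ℝ) := by
    have : 1 * (1 + 2 * Real.log T) ≤ √2 * (1 + 2 * Real.log T) ^ (3 / 2 : ℝ) := by gcongr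
    linarith
  unfold constT
  rw [log_exp_one_mul_sq hT, ← hs]
  have hd := depth_le hT
  calc depth T * (p * M ^ (p - 1)) * (22 + 25 / 2 * √(Real.log (4 * T + 1)))
      ≤ (2 * Real.log T + 2) * (p * M ^ p) * (22 * s + 25 / 2 * (2 * s)) := by
        gcongr
        linarith
    _ = p * M ^ p * s * (47 * (2 * Real.log T + 2)) := by ring
    _ ≤ p * M ^ p * s * (192 * (1 + 4 * (1 + 2 * Real.log T))) := by gcongr ?_ * ?_; linarith
    _ ≤ p * M ^ p * s * (192 * (1 + 4 * √2 * (1 + 2 * Real.log T) ^ (3 / 2 : ℝ))) := by gcongr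
    _ = 4 * 1 * (48 * p * M ^ p * s * (1 + 4 * √2 * (1 + 2 * Real.log T) ^ (3 / 2 : ℝ))) := by ring
    _ ≤ _ := by gcongr

theorem half_le_sqrt_log {δ : ℝ} (hδ : 0 < δ) (hδ1 : δ < 1) : 1 / 2 ≤ √(Real.log (2 / δ)) := by
  apply Real.le_sqrt_of_sq_le
  have : (2 : ℝ) ≤ 2 / δ := by rw [le_div_iff₀ hδ]; linarith
  have := Real.log_le_log two_pos this
  linarith [Real.log_two_gt_d9]

/-- The total excess of the chain is at most the excess in the theorem. -/
theorem chain_total_le {T : ℕ} {p M Λ R δ N : ℝ} (hp : 1 ≤ p) (hM : 1 ≤ M) (hT : 2 ≤ T)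
    (hΛR : 0 ≤ Λ * R) (hδ : 0 < δ) (hδ1 : δ < 1) (hN : 0 ≤ N) :
    (∑ k ∈ Finset.range (depth T), 2 * (5 / 4 * precision M k) * N *
        √(Real.log (((updates T (levelSize M (Λ * R * (p * M ^ (p - 1))) k) ×ˢ
          updates T (levelSize M (Λ * R * (p * M ^ (p - 1))) (k + 1))).card : ℝ)
          / (δ / 2 ^ (k + 1)))))
      + (2 * precision M (depth T) * √T + 22 * depth T * (Λ * R * (p * M ^ (p - 1)))) * N
      ≤ 4 * M * (√(2 * Real.log (2 / δ)) + constT p M T * Λ * R) * N := by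
  have hM0 : 0 < M := by linarith
  have hL : 0 ≤ p * M ^ (p - 1) := mul_nonneg (by linarith) (Real.rpow_nonneg hM0.le _)
  have h1 := sum_majorant_le (T := T) (K := depth T) (mul_nonneg hΛR hL) hM0 hδ hδ1 hN
  refine (add_le_add_left h1 _).trans ?_
  rw [← add_mul]
  refine mul_le_mul_of_nonneg_right ?_ hN
  have h2 := precision_depth_mul_sqrt_le hM0.le hT
  have h3 := mul_le_mul_of_nonneg_left (depth_mul_le hp hM hT) hΛR
  have h4 := half_le_sqrt_log hδ hδ1
  rw [Real.sqrt_mul zero_le_two]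
  -- Of `4√2 ≥ 5.6`, the geometric sum over levels uses `5`; the remaining `0.6 M l ≥ 0.3 M` pays
  -- for the last-level error `M / 4`.
  have h5 : (1.4 : ℝ) ≤ √2 := Real.le_sqrt_of_sq_le (by norm_num)
  set l := √(Real.log (2 / δ))
  have h6 : M * l * 1.4 ≤ M * l * √2 := by gcongr
  have h7 : M * (1 / 2) ≤ M * l := by gcongr
  linarith

/-! ### A measurable substitute for the domain of the process. -/

section Admissible

variable {𝒳 : Type*} {ℋ : Type*} [NormedAddCommGroup ℋ] [InnerProductSpace ℝ ℋ]

/-- The points at which the residuals and the losses of the hypotheses in the ball are at most `M`. -/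
def admissible (Ψ : 𝒳 → ℋ) (p Λ M : ℝ) : Set (𝒳 × ℝ) :=
  {z | Λ * ‖Ψ z.1‖ + |z.2| ≤ M ∧ (Λ * ‖Ψ z.1‖ + |z.2|) ^ p ≤ M}

omit [InnerProductSpace ℝ ℋ] in
theorem measurableSet_admissible [MeasurableSpace 𝒳] {Ψ : 𝒳 → ℋ} (hΨ : StronglyMeasurable Ψ)
    (p Λ M : ℝ) : MeasurableSet (admissible Ψ p Λ M) := by
  have h : Measurable fun z : 𝒳 × ℝ => Λ * ‖Ψ z.1‖ + |z.2| :=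
    ((hΨ.norm.measurable.comp measurable_fst).const_mul Λ).add
      (continuous_abs.measurable.comp measurable_snd)
  exact (measurableSet_le h measurable_const).inter
    (measurableSet_le (h.pow_const p) measurable_const)

theorem le_of_mem_admissible {Ψ : 𝒳 → ℋ} {p Λ M : ℝ} (hp : 0 ≤ p) {a : ℋ} (ha : ‖a‖ ≤ Λ)
    {z : 𝒳 × ℝ} (hz : z ∈ admissible Ψ p Λ M) :
    |⟪a, Ψ z.1⟫ - z.2| ≤ M ∧ powerLoss Ψ p a z ≤ M := by
  have h : |⟪a, Ψ z.1⟫ - z.2| ≤ Λ * ‖Ψ z.1‖ + |z.2| :=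
    (abs_sub _ _).trans (add_le_add ((abs_real_inner_le_norm _ _).trans (by gcongr)) le_rfl)
  exact ⟨h.trans hz.1, (Real.rpow_le_rpow (abs_nonneg _) h hp).trans hz.2⟩

/-- For `v ≠ 0`, the multiple of `v` of norm `Λ` with sign opposite to `y` is extremal. Hence a
bound for all `a` is a single measurable condition on the point, as needed for conditional laws when
`𝒴` is an arbitrary set. -/
theorem exists_abs_inner_sub_eq (v : ℋ) (y : ℝ) {Λ : ℝ} (hΛ : 0 ≤ Λ) :
    ∃ a : ℋ, ‖a‖ ≤ Λ ∧ |⟪a, v⟫ - y| = Λ * ‖v‖ + |y| := by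
  rcases eq_or_ne v 0 with rfl | hv
  · exact ⟨0, by simpa using hΛ, by simp⟩
  · have hn : 0 < ‖v‖ := norm_pos_iff.2 hv
    obtain ⟨σ, hσ, hy⟩ : ∃ σ : ℝ, |σ| = 1 ∧ y = -σ * |y| := by
      rcases le_total 0 y with h | h
      · exact ⟨-1, by simp, by simp [abs_of_nonneg h]⟩
      · exact ⟨1, by simp, by simp [abs_of_nonpos h]⟩
    refine ⟨(σ * (Λ / ‖v‖)) • v, ?_, ?_⟩
    · rw [norm_smul, Real.norm_eq_abs, abs_mul, hσ, one_mul, abs_of_nonneg (by positivity),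
        div_mul_cancel₀ _ hn.ne']
    · have : ⟪(σ * (Λ / ‖v‖)) • v, v⟫ - y = σ * (Λ * ‖v‖ + |y|) := by
        rw [real_inner_smul_left, real_inner_self_eq_norm_sq]
        conv_lhs => rw [hy]
        field_simp
        ring
      rw [this, abs_mul, hσ, one_mul, abs_of_nonneg (by positivity)]

theorem mem_admissible {Ψ : 𝒳 → ℋ} {p Λ M : ℝ} (hΛ : 0 ≤ Λ) {z : 𝒳 × ℝ}
    (h : ∀ a : ℋ, ‖a‖ ≤ Λ → |⟪a, Ψ z.1⟫ - z.2| ≤ M ∧ powerLoss Ψ p a z ≤ M) :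
    z ∈ admissible Ψ p Λ M := by
  obtain ⟨a, ha, hav⟩ := exists_abs_inner_sub_eq (Ψ z.1) z.2 hΛ
  have := h a ha
  rw [powerLoss, hav] at this
  exact this

theorem powerLoss_nonneg (Ψ : 𝒳 → ℋ) (p : ℝ) (a : ℋ) (z : 𝒳 × ℝ) : 0 ≤ powerLoss Ψ p a z :=
  Real.rpow_nonneg (abs_nonneg _) _

theorem measurable_powerLoss [MeasurableSpace 𝒳] {Ψ : 𝒳 → ℋ} (hΨ : StronglyMeasurable Ψ) (p : ℝ)
    (a : ℋ) : Measurable (powerLoss Ψ p a) := by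
  have h : Measurable fun z : 𝒳 × ℝ => ⟪a, Ψ z.1⟫ - z.2 :=
    ((stronglyMeasurable_const.inner hΨ).measurable.comp measurable_fst).sub measurable_snd
  exact (continuous_abs.measurable.comp h).pow_const p

end Admissible

/-! ### The deviation event for fixed weights. -/

/-- Almost surely, the conditional laws are carried by any measurable set that carries the
process. -/
theorem exists_event_condLaw_compl_eq_zero {Ω 𝒵 : Type*} [MeasurableSpace Ω] [MeasurableSpace 𝒵]
    {μ : Measure Ω} [IsProbabilityMeasure μ] {Z : ℕ → Ω → 𝒵} {T : ℕ}
    {κ : (t : ℕ) → Kernel (Fin t → 𝒵) 𝒵} (hZ : ∀ t ≤ T, Measurable (Z t))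
    (hκ : IsRegularCondLaw μ Z T κ) {G : Set 𝒵} (hG : MeasurableSet G)
    (hZG : ∀ t ≤ T, ∀ ω, Z t ω ∈ G) :
    ∃ E : Set Ω, MeasurableSet E ∧ μ Eᶜ = 0 ∧ ∀ ω ∈ E, ∀ t ≤ T, κ t (past Z t ω) Gᶜ = 0 := by
  have hae : ∀ t ∈ Finset.range (T + 1), ∀ᵐ ω ∂μ, κ t (past Z t ω) Gᶜ = 0 := by
    intro t ht
    have ht : t ≤ T := Nat.lt_succ_iff.1 (Finset.mem_range.1 ht)
    obtain ⟨hm, heq⟩ := hκ t ht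
    have hp : Measurable (past Z t) := measurable_past fun s hs => hZ s (hs.le.trans ht)
    have : IsProbabilityMeasure (μ.map (past Z t)) :=
      Measure.isProbabilityMeasure_map hp.aemeasurable
    have h1 : ∀ᵐ x ∂(μ.map (past Z t) ⊗ₘ κ t), x.2 ∈ G := by
      rw [← heq, ae_map_iff (hp.prodMk (hZ t ht)).aemeasurable (measurable_snd hG)]
      exact Filter.Eventually.of_forall (hZG t ht)
    exact ae_of_ae_map hp.aemeasurable (Measure.ae_ae_of_ae_compProd h1)
  have hall := (Filter.eventually_all_finset _).2 hae
  obtain ⟨N, hN, hNm, hN0⟩ := exists_measurable_superset_of_null hall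
  refine ⟨Nᶜ, hNm.compl, by rwa [compl_compl], fun ω hω t ht => ?_⟩
  by_contra h
  exact hω (hN fun hc => h (hc t (Finset.mem_range.2 (Nat.lt_succ_iff.2 ht))))

theorem condMean_mem_Icc {Ω 𝒵 : Type*} [MeasurableSpace 𝒵] {Z : ℕ → Ω → 𝒵} {t : ℕ}
    {κ : (t : ℕ) → Kernel (Fin t → 𝒵) 𝒵} [IsMarkovKernel (κ t)] {f : 𝒵 → ℝ} {M : ℝ} {G : Set 𝒵}
    (hf0 : ∀ z, 0 ≤ f z) (hfM : ∀ z ∈ G, f z ≤ M) {ω : Ω} (hω : κ t (past Z t ω) Gᶜ = 0) :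
    0 ≤ condMean Z κ f t ω ∧ condMean Z κ f t ω ≤ M := by
  refine ⟨integral_nonneg hf0, ?_⟩
  have h : ∀ᵐ z ∂(κ t (past Z t ω)), f z ≤ M := by
    filter_upwards [measure_eq_zero_iff_ae_notMem.1 hω] with z hz
    exact hfM z (by simpa using hz)
  have := integral_mono_of_nonneg (Filter.Eventually.of_forall hf0) (integrable_const M) h
  simpa [condMean] using this

/-- The chain inequality holds for almost every tangent path and is integrated over that path: the
left side becomes the deviation, the walks are replaced by their majorants. The event is an
intersection over levels, independent of `a`, so no supremum over the ball has to be measurable. -/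
theorem exists_deviation_event {Ω 𝒳 ℋ : Type*} [MeasurableSpace Ω] [MeasurableSpace 𝒳]
    [NormedAddCommGroup ℋ] [InnerProductSpace ℝ ℋ] {μ : Measure Ω} [IsProbabilityMeasure μ]
    {Z : ℕ → Ω → 𝒳 × ℝ} {κ : (t : ℕ) → Kernel (Fin t → 𝒳 × ℝ) (𝒳 × ℝ)} {Ψ : 𝒳 → ℋ} {T : ℕ}
    {p Λ R M δ : ℝ} (hp : 1 ≤ p) (hM : 1 ≤ M) (hT : 2 ≤ T) (hδ : 0 < δ) (hδ1 : δ < 1)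
    (hΛ : 0 ≤ Λ) (hR : 0 ≤ R) (hZ : ∀ t ≤ T, Measurable (Z t)) (hκ : IsRegularCondLaw μ Z T κ)
    (hΨ : StronglyMeasurable Ψ) (hΨR : ∀ x, ‖Ψ x‖ ≤ R)
    (hZG : ∀ t ≤ T, ∀ ω, Z t ω ∈ admissible Ψ p Λ M) (q : ℕ → ℝ) :
    ∃ E : Set Ω, MeasurableSet E ∧ μ Eᶜ ≤ ENNReal.ofReal δ ∧ ∀ ω ∈ E, ∀ a : ℋ, ‖a‖ ≤ Λ →
      ∑ t ∈ Finset.range T, q t *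
          (condMean Z κ (powerLoss Ψ p a) t ω - powerLoss Ψ p a (Z t ω))
        ≤ 4 * M * (√(2 * Real.log (2 / δ)) + constT p M T * Λ * R)
          * √(∑ t ∈ Finset.range T, q t ^ 2) := by
  have hM0 : 0 < M := by linarith
  rcases (Finset.sum_nonneg fun t (_ : t ∈ Finset.range T) => sq_nonneg (q t)).eq_or_lt with hq | hq
  · refine ⟨Set.univ, MeasurableSet.univ, by simp, fun ω _ a _ => ?_⟩
    rw [← hq, Real.sqrt_zero, mul_zero]
    refine (Finset.sum_eq_zero fun t ht => ?_).le
    have := (Finset.sum_eq_zero_iff_of_nonneg fun t _ => sq_nonneg (q t)).1 hq.symm t ht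
    rw [pow_eq_zero_iff two_ne_zero] at this
    rw [this, zero_mul]
  set A := Λ * R * (p * M ^ (p - 1)) with hA
  set G := admissible Ψ p Λ M with hG
  have hGm : MeasurableSet G := measurableSet_admissible hΨ p Λ M
  obtain ⟨E₀, hE₀m, hE₀, hE₀G⟩ := exists_event_condLaw_compl_eq_zero hZ hκ hGm hZG
  have hlev : ∀ k, ∃ E : Set Ω, MeasurableSet E ∧ μ Eᶜ ≤ ENNReal.ofReal (δ / 2 ^ (k + 1)) ∧ ∀ ω ∈ E,
      ∃ Y : (Fin T → 𝒳 × ℝ) → ℝ, Integrable Y (tangent κ T (past Z T ω)) ∧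
        ∫ z', Y z' ∂(tangent κ T (past Z T ω))
          ≤ 2 * (5 / 4 * precision M k) * √(∑ t ∈ Finset.range T, q t ^ 2) *
            √(Real.log (((updates T (levelSize M A k) ×ˢ
              updates T (levelSize M A (k + 1))).card : ℝ) / (δ / 2 ^ (k + 1)))) ∧
        ∀ i ∈ updates T (levelSize M A k) ×ˢ updates T (levelSize M A (k + 1)), ∀ z',
          walk q (link Ψ p M R k i) T (past Z T ω) z' ≤ Y z' := by
    intro k
    have he : 0 < precision M k := by unfold precision; positivity
    refine exists_majorant hZ hκ hq ((updates_nonempty T _).product (updates_nonempty T _))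
      (fun i t => measurable_link hΨ p M R k i t) (by positivity)
      (fun i t z z' x => abs_clip_le (by positivity) _) (by positivity) ?_
    have : (1 : ℝ) ≤ 2 ^ (k + 1) := one_le_pow₀ one_le_two
    rw [div_lt_one (by positivity)]
    linarith
  choose E hEm hEμ hEY using hlev
  refine ⟨E₀ ∩ ⋂ k, E k, hE₀m.inter (MeasurableSet.iInter hEm), ?_, ?_⟩
  · rw [Set.compl_inter, Set.compl_iInter]
    refine (measure_union_le _ _).trans ?_
    rw [hE₀, zero_add]
    refine (measure_iUnion_le _).trans ((ENNReal.tsum_le_tsum hEμ).trans (le_of_eq ?_))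
    have hs : HasSum (fun k : ℕ => δ / 2 ^ (k + 1)) δ := by
      convert hasSum_geometric_two' δ using 2 with k
      rw [pow_succ]
      field_simp
    rw [← ENNReal.ofReal_tsum_of_nonneg (fun k => by positivity) hs.summable, hs.tsum_eq]
  · rintro ω ⟨hω₀, hω⟩ a ha
    rw [Set.mem_iInter] at hω
    choose Y hYi hYm hYw using fun k => hEY k ω (hω k)
    have hmk := isMarkovKernel_tangent fun t (ht : t < T) => (hκ t ht.le).1
    set Q := tangent κ T (past Z T ω) with hQ
    have hmap : ∀ t (ht : t < T), Q.map (fun z' => z' ⟨t, ht⟩) = κ t (past Z t ω) := fun t ht =>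
      tangent_map_apply (fun t ht => (hκ t ht.le).1) (fun i => Z i ω) ht
    have hQG : ∀ᵐ z' ∂Q, ∀ t (ht : t < T), z' ⟨t, ht⟩ ∈ G := by
      have : ∀ i : Fin T, ∀ᵐ z' ∂Q, z' i ∈ G := by
        intro i
        have h : ∀ᵐ z ∂(Q.map fun z' : Fin T → 𝒳 × ℝ => z' i), z ∈ G := by
          rw [hmap i i.2, ae_iff]
          exact hE₀G ω hω₀ i i.2.le
        exact ae_of_ae_map (measurable_pi_apply i).aemeasurable h
      filter_upwards [ae_all_iff.2 this] with z' hz' t ht using hz' ⟨t, ht⟩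
    have hf := measurable_powerLoss hΨ p a
    have hint : ∀ i : Fin T, Integrable (fun z' => powerLoss Ψ p a (z' i)) Q := by
      intro i
      refine Integrable.of_bound (hf.comp (measurable_pi_apply i)).aestronglyMeasurable M ?_
      filter_upwards [hQG] with z' hz'
      rw [Real.norm_of_nonneg (powerLoss_nonneg _ _ _ _)]
      exact (le_of_mem_admissible (by linarith) ha (hz' i i.2)).2
    have hmean : ∀ i : Fin T, ∫ z', powerLoss Ψ p a (z' i) ∂Q
        = condMean Z κ (powerLoss Ψ p a) i ω := by
      intro i
      rw [condMean, ← hmap i i.2, integral_map (measurable_pi_apply _).aemeasurable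
        hf.aestronglyMeasurable]
    set c := (2 * precision M (depth T) * √T + 22 * depth T * A) * √(∑ t ∈ Finset.range T, q t ^ 2)
      with hc
    -- The experts depend on `a` and on `z'`, with no measurability of their choice; the majorants
    -- `Y k` depend on neither the choice nor `a`, and can be integrated.
    have hle : ∀ᵐ z' ∂Q, ∑ i : Fin T, q i * (powerLoss Ψ p a (z' i) - powerLoss Ψ p a (Z i ω))
        ≤ ∑ k ∈ Finset.range (depth T), Y k z' + c := by
      filter_upwards [hQG] with z' hz'
      -- The value at times `T` and later is arbitrary.
      set zz' : ℕ → 𝒳 × ℝ := fun t => if h : t < T then z' ⟨t, h⟩ else Z 0 ω with hzz'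
      have hzT : ∀ t (h : t < T), zz' t = z' ⟨t, h⟩ := fun t h => dif_pos h
      obtain ⟨S, hS, hle⟩ := exists_chain hp hM0 hΨR ha (T := T) (zz := fun i => Z i ω) (zz' := zz')
        (fun t ht => le_of_mem_admissible (by linarith) ha (hZG t ht.le ω))
        (fun t ht => le_of_mem_admissible (by linarith) ha (by rw [hzT t ht]; exact hz' t ht))
        q (depth T)
      rw [Finset.sum_range] at hle
      have hzz : (fun i : Fin T => zz' i) = z' := funext fun i => hzT i i.2
      simp only [hzz] at hle
      have hzi : ∀ i : Fin T, zz' i = z' i := fun i => hzT i i.2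
      simp only [hzi] at hle
      refine hle.trans (add_le_add (Finset.sum_le_sum fun k _ => ?_) le_rfl)
      exact hYw k _ (Finset.mem_product.2 ⟨hS k, hS (k + 1)⟩) z'
    have hi0 : ∀ i : Fin T, Integrable (fun z' =>
        q i * (powerLoss Ψ p a (z' i) - powerLoss Ψ p a (Z i ω))) Q := fun i =>
      ((hint i).sub (integrable_const _)).const_mul _
    have hi1 : Integrable (fun z' => ∑ i : Fin T,
        q i * (powerLoss Ψ p a (z' i) - powerLoss Ψ p a (Z i ω))) Q :=
      integrable_finsetSum _ fun i _ => hi0 i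
    have hi2 : Integrable (fun z' => ∑ k ∈ Finset.range (depth T), Y k z') Q :=
      integrable_finsetSum _ fun k _ => hYi k
    have h : ∫ z', ∑ i : Fin T, q i * (powerLoss Ψ p a (z' i) - powerLoss Ψ p a (Z i ω)) ∂Q
        ≤ ∫ z', (∑ k ∈ Finset.range (depth T), Y k z' + c) ∂Q :=
      integral_mono_ae hi1 (hi2.add (integrable_const c)) hle
    rw [integral_finsetSum _ fun i _ => hi0 i] at h
    simp only [integral_const_mul, integral_sub (hint _) (integrable_const _), hmean, integral_const,
      probReal_univ, one_smul, integral_add hi2 (integrable_const c)] at h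
    rw [integral_finsetSum _ fun k _ => hYi k] at h
    rw [Finset.sum_range]
    refine h.trans ((add_le_add_left (Finset.sum_le_sum fun k _ => hYm k) c).trans ?_)
    exact chain_total_le hp hM hT (mul_nonneg hΛ hR) hδ hδ1 (Real.sqrt_nonneg _)

/-! ### From fixed weights to all weights in a scenario. -/

theorem l1_nonneg {T : ℕ} (q : Fin T → ℝ) : 0 ≤ l1 q := Finset.sum_nonneg fun _ _ => abs_nonneg _

theorem l2_nonneg {T : ℕ} (q : Fin T → ℝ) : 0 ≤ l2 q := Real.sqrt_nonneg _

theorem constT_nonneg {p M : ℝ} (hp : 0 ≤ p) (hM : 0 ≤ M) {T : ℕ} (hT : 1 ≤ T) :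
    0 ≤ constT p M T := by
  have hT' : (1 : ℝ) ≤ T := by exact_mod_cast hT
  have h : 0 ≤ Real.log (Real.exp 1 * (T : ℝ) ^ 2) := by
    apply Real.log_nonneg
    have h1 : 1 ≤ Real.exp 1 := Real.one_le_exp zero_le_one
    have h2 : (1 : ℝ) ≤ (T : ℝ) ^ 2 := one_le_pow₀ hT'
    nlinarith
  have h3 := Real.rpow_nonneg h (3 / 2)
  have h4 := Real.rpow_nonneg hM p
  unfold constT
  positivity

theorem abs_sum_mul_le {T : ℕ} (q : Fin T → ℝ) {d : Fin T → ℝ} {M : ℝ} (hd : ∀ t, |d t| ≤ M) :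
    |∑ t, q t * d t| ≤ M * l1 q := by
  rw [l1, Finset.mul_sum]
  refine (Finset.abs_sum_le_sum_abs _ _).trans (Finset.sum_le_sum fun t _ => ?_)
  rw [abs_mul, mul_comm]
  gcongr
  exact hd t

theorem l1_eq_l2_of_lt_two {T : ℕ} (hT : T < 2) (q : Fin T → ℝ) : l1 q = l2 q := by
  interval_cases T <;> simp [l1, l2, Real.sqrt_sq_eq_abs]

section Scenario

variable {Ω : Type u} [MeasurableSpace Ω] {μ : Measure Ω} [IsProbabilityMeasure μ]
  {𝒳 : Type v} [MeasurableSpace 𝒳] {ℋ : Type w} [NormedAddCommGroup ℋ] [InnerProductSpace ℝ ℋ]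
  {Z : ℕ → Ω → 𝒳 × ℝ} {κ : (t : ℕ) → Kernel (Fin t → 𝒳 × ℝ) (𝒳 × ℝ)} {𝒴 : Set ℝ} {Ψ : 𝒳 → ℋ}
  {T : ℕ} {p Λ M δ : ℝ}

omit [IsProbabilityMeasure μ] in
theorem IsScenario.mem_admissible (h : IsScenario μ Z κ 𝒴 Ψ T p Λ M) (hΛ : 0 ≤ Λ) (x : 𝒳) {y : ℝ}
    (hy : y ∈ 𝒴) : (x, y) ∈ admissible Ψ p Λ M :=
  Forecast.mem_admissible hΛ fun a ha => ⟨h.residual_le x y hy a ha,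
    (le_abs_self _).trans (h.loss_le _ ⟨a, ha, rfl⟩ x y hy)⟩

/-- An unbounded real supremum is `0` by convention, so boundedness comes first: for `Λ > 0`
admissibility gives `‖Ψ x‖ ≤ M / Λ`. -/
theorem IsScenario.norm_le_featureRadius (h : IsScenario μ Z κ 𝒴 Ψ T p Λ M) (hΛ : 0 < Λ) (x : 𝒳) :
    ‖Ψ x‖ ≤ featureRadius Ψ := by
  obtain ⟨ω⟩ : Nonempty Ω := nonempty_of_isProbabilityMeasure μ
  have hb : ∀ x, ‖Ψ x‖ ≤ M / Λ := fun x => by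
    rw [le_div_iff₀ hΛ]
    have := (h.mem_admissible hΛ.le x (h.output_mem 0 (Nat.zero_le T) ω)).1
    dsimp only at this
    linarith [abs_nonneg (Z 0 ω).2]
  have hbdd : BddAbove (Set.range fun x => ⟪Ψ x, Ψ x⟫) := by
    refine ⟨(M / Λ) ^ 2, ?_⟩
    rintro _ ⟨x, rfl⟩
    dsimp only
    rw [real_inner_self_eq_norm_sq]
    gcongr
    exact hb x
  apply Real.le_sqrt_of_sq_le
  rw [← real_inner_self_eq_norm_sq]
  exact le_ciSup hbdd x

/-- The deviation bound at the fixed weights `qs`. -/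
theorem IsScenario.exists_deviation_event (h : IsScenario μ Z κ 𝒴 Ψ T p Λ M) (hp : 1 ≤ p)
    (hM : 1 ≤ M) (hδ : 0 < δ) (hδ1 : δ < 1) (hΛ : 0 ≤ Λ) (qs : Fin T → ℝ) :
    ∃ E : Set Ω, MeasurableSet E ∧ μ Eᶜ ≤ ENNReal.ofReal δ ∧ ∀ ω ∈ E, ∀ a : ℋ, ‖a‖ ≤ Λ →
      (∀ t ≤ T, 0 ≤ condMean Z κ (powerLoss Ψ p a) t ω ∧
        condMean Z κ (powerLoss Ψ p a) t ω ≤ M) ∧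
      ∑ t : Fin T, qs t * (condMean Z κ (powerLoss Ψ p a) t ω - powerLoss Ψ p a (Z t ω))
        ≤ 4 * M * (√(2 * Real.log (2 / δ)) + constT p M T * Λ * featureRadius Ψ) * l2 qs := by
  have hZG : ∀ t ≤ T, ∀ ω, Z t ω ∈ admissible Ψ p Λ M := fun t ht ω =>
    h.mem_admissible hΛ _ (h.output_mem t ht ω)
  obtain ⟨E₀, hE₀m, hE₀, hE₀G⟩ := exists_event_condLaw_compl_eq_zero h.measurable_process h.condLaw
    (measurableSet_admissible h.measurable_feature p Λ M) hZG
  have hmean : ∀ ω ∈ E₀, ∀ a : ℋ, ‖a‖ ≤ Λ → ∀ t ≤ T, 0 ≤ condMean Z κ (powerLoss Ψ p a) t ω ∧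
        condMean Z κ (powerLoss Ψ p a) t ω ≤ M := by
    intro ω hω a ha t ht
    have := (h.condLaw t ht).1
    exact condMean_mem_Icc (powerLoss_nonneg Ψ p a)
      (fun z hz => (le_of_mem_admissible (by linarith) ha hz).2) (hE₀G ω hω t ht)
  rcases lt_or_ge T 2 with hT | hT
  -- Here `log T = 0` (also for `T = 0`), so `constT` vanishes. The trivial bound `M ‖q*‖₁ = M
  -- ‖q*‖₂` suffices, since the confidence factor is at least `1/2`.
  · refine ⟨E₀, hE₀m, by rw [hE₀]; exact zero_le, fun ω hω a ha => ⟨hmean ω hω a ha, ?_⟩⟩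
    have hd : ∀ t : Fin T,
        |condMean Z κ (powerLoss Ψ p a) t ω - powerLoss Ψ p a (Z t ω)| ≤ M := by
      intro t
      have h1 := hmean ω hω a ha t t.2.le
      have h2 := powerLoss_nonneg Ψ p a (Z t ω)
      have h3 := (le_of_mem_admissible (by linarith) ha (hZG t t.2.le ω)).2
      exact abs_le.2 ⟨by linarith, by linarith⟩
    have hc : constT p M T = 0 := by
      interval_cases T <;> simp [constT]
    refine (le_abs_self _).trans ((abs_sum_mul_le qs hd).trans ?_)
    rw [l1_eq_l2_of_lt_two hT, hc, zero_mul, zero_mul, add_zero, Real.sqrt_mul zero_le_two]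
    have h4 := half_le_sqrt_log hδ hδ1
    have h5 : (1 : ℝ) ≤ √2 := Real.one_le_sqrt.2 one_le_two
    have h6 : 1 * (1 / 2) ≤ √2 * √(Real.log (2 / δ)) := by gcongr
    refine mul_le_mul_of_nonneg_right ?_ (l2_nonneg qs)
    nlinarith
  · set q : ℕ → ℝ := fun t => if ht : t < T then qs ⟨t, ht⟩ else 0 with hq
    have hqt : ∀ t : Fin T, q t = qs t := fun t => by simp [hq]
    have hq2 : √(∑ t ∈ Finset.range T, q t ^ 2) = l2 qs := by
      rw [l2, Finset.sum_range]
      simp only [hqt]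
    obtain ⟨E, hEm, hE, hdev⟩ : ∃ E : Set Ω, MeasurableSet E ∧ μ Eᶜ ≤ ENNReal.ofReal δ ∧
        ∀ ω ∈ E, ∀ a : ℋ, ‖a‖ ≤ Λ → ∑ t ∈ Finset.range T, q t *
            (condMean Z κ (powerLoss Ψ p a) t ω - powerLoss Ψ p a (Z t ω))
          ≤ 4 * M * (√(2 * Real.log (2 / δ)) + constT p M T * Λ * featureRadius Ψ)
            * √(∑ t ∈ Finset.range T, q t ^ 2) := by
      rcases hΛ.eq_or_lt with rfl | hΛ'
      -- At `Λ = 0` the features may be unbounded and `featureRadius` meaningless. Only `a = 0`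
      -- remains, and the zero feature map yields the same losses.
      · obtain ⟨E, hEm, hE, hdev⟩ := Forecast.exists_deviation_event (Ψ := fun _ : 𝒳 => (0 : ℋ))
          (R := 0) hp hM hT hδ hδ1 le_rfl le_rfl h.measurable_process h.condLaw
          stronglyMeasurable_const (by simp) (fun t ht ω => by
            have := hZG t ht ω
            simp only [admissible, zero_mul, Set.mem_ofPred_eq] at this ⊢
            exact this) q
        refine ⟨E, hEm, hE, fun ω hω a ha => ?_⟩
        have ha0 : a = 0 := norm_le_zero_iff.1 ha
        have hl : powerLoss Ψ p a = powerLoss (fun _ : 𝒳 => (0 : ℋ)) p 0 := by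
          funext z
          simp [powerLoss, ha0]
        rw [hl]
        simpa using hdev ω hω 0 (by simp)
      · exact Forecast.exists_deviation_event hp hM hT hδ hδ1 hΛ (Real.sqrt_nonneg _)
          h.measurable_process h.condLaw h.measurable_feature (h.norm_le_featureRadius hΛ') hZG q
    refine ⟨E₀ ∩ E, hE₀m.inter hEm, ?_, fun ω hω a ha => ⟨hmean ω hω.1 a ha, ?_⟩⟩
    · rw [Set.compl_inter]
      exact (measure_union_le _ _).trans (by rwa [hE₀, zero_add])
    · have := hdev ω hω.2 a ha
      rw [hq2, Finset.sum_range] at this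
      simpa only [hqt] using this

omit [MeasurableSpace Ω] in
/-- The passage from the weights `qs` to all weights `q`. -/
theorem condMean_le_of_deviation {ω : Ω} {β : ℝ} {qs : Fin T → ℝ}
    (hmean : ∀ a : ℋ, ‖a‖ ≤ Λ → ∀ t ≤ T, 0 ≤ condMean Z κ (powerLoss Ψ p a) t ω ∧
        condMean Z κ (powerLoss Ψ p a) t ω ≤ M)
    (hloss : ∀ a : ℋ, ‖a‖ ≤ Λ → ∀ t ≤ T, powerLoss Ψ p a (Z t ω) ≤ M)
    (hdev : ∀ a : ℋ, ‖a‖ ≤ Λ →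
      ∑ t : Fin T, qs t * (condMean Z κ (powerLoss Ψ p a) t ω - powerLoss Ψ p a (Z t ω)) ≤ β)
    {a : ℋ} (ha : ‖a‖ ≤ Λ) (q : Fin T → ℝ) :
    condMean Z κ (powerLoss Ψ p a) T ω ≤
      ∑ t : Fin T, q t * powerLoss Ψ p a (Z t ω) + disc Z κ (lossClass Ψ p Λ) q ω
        + (β + M * l1 (q - qs)) := by
  -- Boundedness makes the real supremum in `disc` a genuine upper bound.
  have hbdd : BddAbove (Set.range fun f : lossClass Ψ p Λ =>
      condMean Z κ f T ω - ∑ t : Fin T, q t * condMean Z κ f t ω) := by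
    refine ⟨M + M * l1 q, ?_⟩
    rintro _ ⟨⟨f, b, hb, rfl⟩, rfl⟩
    have h1 := (hmean b hb T le_rfl).2
    have h2 := abs_sum_mul_le q (d := fun t => condMean Z κ (powerLoss Ψ p b) t ω) (M := M)
      fun t => by
        have := hmean b hb t t.2.le
        rw [abs_of_nonneg this.1]
        exact this.2
    dsimp only
    linarith [neg_abs_le (∑ t : Fin T, q t * condMean Z κ (powerLoss Ψ p b) t ω)]
  have h1 : condMean Z κ (powerLoss Ψ p a) T ω
      - ∑ t : Fin T, q t * condMean Z κ (powerLoss Ψ p a) t ω ≤ disc Z κ (lossClass Ψ p Λ) q ω :=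
    le_ciSup hbdd ⟨powerLoss Ψ p a, a, ha, rfl⟩
  have h2 := abs_sum_mul_le (q - qs)
    (d := fun t => condMean Z κ (powerLoss Ψ p a) t ω - powerLoss Ψ p a (Z t ω)) (M := M)
    fun t => by
      have h3 := hmean a ha t t.2.le
      have h4 := hloss a ha t t.2.le
      have h5 := powerLoss_nonneg Ψ p a (Z t ω)
      exact abs_le.2 ⟨by linarith, by linarith⟩
  have h3 := hdev a ha
  have h4 := le_abs_self (∑ t : Fin T, (q - qs) t *
    (condMean Z κ (powerLoss Ψ p a) t ω - powerLoss Ψ p a (Z t ω)))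
  simp only [Pi.sub_apply, sub_mul, mul_sub, Finset.sum_sub_distrib] at h2 h3 h4
  linarith

theorem IsScenario.exists_event (h : IsScenario μ Z κ 𝒴 Ψ T p Λ M) (hp : 1 ≤ p) (hM : 1 ≤ M)
    (hδ : 0 < δ) (qs : Fin T → ℝ) :
    ∃ E : Set Ω, MeasurableSet E ∧ 1 - ENNReal.ofReal δ ≤ μ E ∧ ∀ ω ∈ E, ∀ a : ℋ, ‖a‖ ≤ Λ →
      ∀ q : Fin T → ℝ, condMean Z κ (powerLoss Ψ p a) T ω ≤
        ∑ t : Fin T, q t * powerLoss Ψ p a (Z t ω) + disc Z κ (lossClass Ψ p Λ) q ω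
          + (4 * M * (√(2 * Real.log (2 / δ)) + constT p M T * Λ * featureRadius Ψ) * l2 qs
            + M * l1 (q - qs)) := by
  rcases le_or_gt 1 δ with hδ1 | hδ1
  · refine ⟨∅, MeasurableSet.empty, ?_, fun ω hω => absurd hω (Set.notMem_empty ω)⟩
    rw [tsub_eq_zero_of_le (by simpa using hδ1)]
    exact zero_le
  rcases lt_or_ge Λ 0 with hΛ | hΛ
  · refine ⟨Set.univ, MeasurableSet.univ, by simp, fun ω _ a ha => ?_⟩
    linarith [norm_nonneg a]
  obtain ⟨E, hEm, hE, hdev⟩ := h.exists_deviation_event hp hM hδ hδ1 hΛ qs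
  refine ⟨E, hEm, ?_, fun ω hω a ha q => ?_⟩
  · rw [← compl_compl E, prob_compl_eq_one_sub hEm.compl]
    exact tsub_le_tsub_left hE 1
  · exact condMean_le_of_deviation (fun a ha => (hdev ω hω a ha).1)
      (fun a ha t ht => (le_of_mem_admissible (by linarith) ha
        (h.mem_admissible hΛ _ (h.output_mem t ht ω))).2) (fun a ha => (hdev ω hω a ha).2) ha q

end Scenario

/-! ### Comparison with the stated penalty and rate. -/

/-- In terms of `s = √(log T)`, the root contributes `s` and the bracket `O(s³)`, the latter because
`log T` is bounded below for `T ≥ 2`. -/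
theorem constT_two_le {M : ℝ} {T : ℕ} (hT : 2 ≤ T) :
    constT 2 M T ≤ 9600 * M ^ 2 * Real.log T ^ 2 := by
  have hT' : (2 : ℝ) ≤ T := by exact_mod_cast hT
  have hlog : 0.69 < Real.log T :=
    lt_of_lt_of_le (by linarith [Real.log_two_gt_d9]) (Real.log_le_log two_pos hT')
  unfold constT
  rw [log_exp_one_mul_sq hT, Real.rpow_two, Real.sqrt_mul Real.pi_pos.le]
  set x := Real.log T with hx
  have hs := Real.sq_sqrt (show 0 ≤ x by linarith)
  set s := √x with hsx
  have hs0 : 0.83 ≤ s := Real.le_sqrt_of_sq_le (by norm_num; linarith)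
  have hpi : √Real.pi ≤ 2 := Real.sqrt_le_iff.2 ⟨by norm_num, by linarith [Real.pi_lt_four]⟩
  have h2 : √2 ≤ 1.5 := Real.sqrt_le_iff.2 ⟨by norm_num, by norm_num⟩
  have hB : (1 + 2 * x) ^ (3 / 2 : ℝ) ≤ 8 * s ^ 3 := by
    have h4 : 1 + 2 * x ≤ (2 * s) ^ 2 := by nlinarith
    calc (1 + 2 * x) ^ (3 / 2 : ℝ) ≤ ((2 * s) ^ 2) ^ (3 / 2 : ℝ) :=
          Real.rpow_le_rpow (by linarith) h4 (by norm_num)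
      _ = 8 * s ^ 3 := by
          rw [← Real.rpow_natCast_mul (by linarith)]
          norm_num
          rw [mul_pow]
          norm_num
  have hs3 : 1 ≤ 2 * s ^ 3 := by
    have : (0.83 : ℝ) ^ 3 ≤ s ^ 3 := by gcongr
    norm_num at this ⊢
    linarith
  have h5 : 1 + 4 * √2 * (1 + 2 * x) ^ (3 / 2 : ℝ) ≤ 50 * s ^ 3 := by
    have : √2 * (1 + 2 * x) ^ (3 / 2 : ℝ) ≤ 1.5 * (8 * s ^ 3) := by gcongr
    linarith
  calc 48 * 2 * M ^ 2 * (√Real.pi * s) * (1 + 4 * √2 * (1 + 2 * x) ^ (3 / 2 : ℝ))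
      ≤ 48 * 2 * M ^ 2 * (2 * s) * (50 * s ^ 3) := by gcongr
    _ = 9600 * M ^ 2 * (s ^ 2) ^ 2 := by ring
    _ = _ := by rw [hs]

theorem coe_le_coe_add {x y z : ℝ} {B : EReal} (h : x ≤ y + z) (hB : (z : EReal) ≤ B) :
    (x : EReal) ≤ (y : EReal) + B :=
  (EReal.coe_le_coe_iff.2 h).trans (by rw [EReal.coe_add]; exact add_le_add le_rfl hB)

theorem excess_le_penalty {p M δ Λ r : ℝ} (hM : 1 ≤ M) {T : ℕ} (hc : 0 ≤ constT p M T * Λ * r)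
    (qs q : Fin T → ℝ) :
    ((4 * M * (√(2 * Real.log (2 / δ)) + constT p M T * Λ * r) * l2 qs + M * l1 (q - qs) : ℝ)
      : EReal) ≤ penalty p M δ Λ r qs q + ((4 * M * l1 (q - qs) : ℝ) : EReal) := by
  unfold penalty
  split_ifs with h
  · rw [← EReal.coe_add, EReal.coe_le_coe_iff]
    have h1 := l1_nonneg (q - qs)
    have h2 := l2_nonneg qs
    have h3 : 0 ≤ √(2 * logLog (l1 (q - qs))) := Real.sqrt_nonneg _
    have h4 : 0 ≤ √(2 * Real.log (2 / δ)) := Real.sqrt_nonneg _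
    have h5 : (√(2 * Real.log (2 / δ)) + constT p M T * Λ * r) * l2 qs
        ≤ (√(2 * Real.log (2 / δ)) + √(2 * logLog (l1 (q - qs))) + constT p M T * Λ * r)
          * (l2 qs + 2 * l1 (q - qs)) :=
      mul_le_mul (by linarith) (by linarith) h2 (by linarith)
    have h6 := mul_le_mul_of_nonneg_left h5 (show 0 ≤ 4 * M by linarith)
    have h7 := mul_nonneg (show 0 ≤ M by linarith) h1
    linarith
  · rw [EReal.top_add_coe]
    exact le_top

/-- The constant of the rate for `p = 2`. -/
noncomputable def rateConst (M δ : ℝ) : ℝ :=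
  16 * M * √(2 * Real.log (2 / δ)) + 38400 * M ^ 3 + 4 * M

/-- As `log T ≥ log 2 > 1/2`, one has `1 ≤ 4 log² T`, which lets terms without a logarithm enter the
rate. The summands of `rateConst` pay for the confidence term, for `constT` (`38400 = 4 · 9600`) and
for `M ‖q - q*‖₁`. -/
theorem excess_le_rate {M δ Λ r : ℝ} (hM : 1 ≤ M) {T : ℕ} (hT : 2 ≤ T) (hΛr : 0 ≤ Λ * r)
    (qs q : Fin T → ℝ) :
    ((4 * M * (√(2 * Real.log (2 / δ)) + constT 2 M T * Λ * r) * l2 qs + M * l1 (q - qs) : ℝ)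
      : EReal) ≤ (rateConst M δ : EReal) * rate Λ r qs q := by
  have hC : 0 < rateConst M δ := by unfold rateConst; positivity
  unfold rate
  split_ifs with h
  · rw [← EReal.coe_mul, EReal.coe_le_coe_iff]
    have h1 := l1_nonneg (q - qs)
    have h2 := l2_nonneg qs
    have h3 : 0 ≤ √(logLog (l1 (q - qs))) := Real.sqrt_nonneg _
    have hT' : (2 : ℝ) ≤ T := by exact_mod_cast hT
    have hlog : 0.69 < Real.log T :=
      lt_of_lt_of_le (by linarith [Real.log_two_gt_d9]) (Real.log_le_log two_pos hT')
    have hX : 1 ≤ 4 * Real.log T ^ 2 := by nlinarith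
    have hcT := mul_le_mul_of_nonneg_right (constT_two_le (M := M) hT) hΛr
    set X := Real.log T ^ 2
    set s := √(2 * Real.log (2 / δ)) with hs
    have h4 : 0 ≤ s := Real.sqrt_nonneg _
    set a := l2 qs
    set b := l1 (q - qs)
    have hX0 : 0 ≤ X := by linarith
    have e1 : 4 * M * (s + constT 2 M T * Λ * r)
        ≤ 16 * M * s * X + 38400 * M ^ 3 * X * (Λ * r) := by
      have e2 : M * s * 1 ≤ M * s * (4 * X) := by gcongr
      have e3 : M * (constT 2 M T * (Λ * r)) ≤ M * (9600 * M ^ 2 * X * (Λ * r)) := by gcongr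
      linarith
    have e4 : M * 1 ≤ M * (4 * X) := by gcongr
    have e5 : 16 * M * s * X + 38400 * M ^ 3 * X * (Λ * r) ≤ rateConst M δ * ((1 + Λ * r) * X) := by
      unfold rateConst
      rw [← hs]
      have : 0 ≤ 16 * M * s * X * (Λ * r) + 38400 * M ^ 3 * X + 4 * M * X * (1 + Λ * r) := by
        positivity
      linarith
    have e6 : M ≤ rateConst M δ * ((1 + Λ * r) * X) := by
      unfold rateConst
      rw [← hs]
      have : 0 ≤ (16 * M * s + 38400 * M ^ 3) * ((1 + Λ * r) * X) + 4 * M * X * (Λ * r) := by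
        positivity
      linarith
    calc 4 * M * (s + constT 2 M T * Λ * r) * a + M * b
        ≤ rateConst M δ * ((1 + Λ * r) * X) * a + rateConst M δ * ((1 + Λ * r) * X) * b := by
          exact add_le_add (mul_le_mul_of_nonneg_right (e1.trans e5) h2)
            (mul_le_mul_of_nonneg_right e6 h1)
      _ = rateConst M δ * ((1 + Λ * r) * X * 1 * (a + b)) := by ring
      _ ≤ _ := by gcongr; linarith
  · rw [EReal.coe_mul_top_of_pos hC]
    exact le_top

end Forecast

theorem mainTheorem12 (M δ : ℝ) (hM : 1 ≤ M) (hδ : 0 < δ) :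
    (∀ (Ω : Type u) [MeasurableSpace Ω] (μ : Measure Ω) [IsProbabilityMeasure μ]
      (𝒳 : Type v) [MeasurableSpace 𝒳]
      (ℋ : Type w) [NormedAddCommGroup ℋ] [InnerProductSpace ℝ ℋ] [CompleteSpace ℋ]
      (Z : ℕ → Ω → 𝒳 × ℝ) (κ : (t : ℕ) → Kernel (Fin t → 𝒳 × ℝ) (𝒳 × ℝ))
      (𝒴 : Set ℝ) (Ψ : 𝒳 → ℋ) (T : ℕ) (p Λ : ℝ), 1 ≤ p →
      Forecast.IsScenario μ Z κ 𝒴 Ψ T p Λ M → ∀ qs : Fin T → ℝ,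
      ∃ E : Set Ω, MeasurableSet E ∧ 1 - ENNReal.ofReal δ ≤ μ E ∧
        ∀ ω ∈ E, Forecast.UniformBound Z κ Ψ p Λ qs
          (fun q => Forecast.penalty p M δ Λ (Forecast.featureRadius Ψ) qs q
            + ((4 * M * Forecast.l1 (q - qs) : ℝ) : EReal)) ω) ∧
    (∃ C : ℝ, 0 < C ∧
      ∀ (Ω : Type u) [MeasurableSpace Ω] (μ : Measure Ω) [IsProbabilityMeasure μ]
      (𝒳 : Type v) [MeasurableSpace 𝒳]
      (ℋ : Type w) [NormedAddCommGroup ℋ] [InnerProductSpace ℝ ℋ] [CompleteSpace ℋ]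
      (Z : ℕ → Ω → 𝒳 × ℝ) (κ : (t : ℕ) → Kernel (Fin t → 𝒳 × ℝ) (𝒳 × ℝ))
      (𝒴 : Set ℝ) (Ψ : 𝒳 → ℋ) (T : ℕ) (Λ : ℝ), 2 ≤ T →
      Forecast.IsScenario μ Z κ 𝒴 Ψ T 2 Λ M → ∀ qs : Fin T → ℝ,
      ∃ E : Set Ω, MeasurableSet E ∧ 1 - ENNReal.ofReal δ ≤ μ E ∧
        ∀ ω ∈ E, Forecast.UniformBound Z κ Ψ 2 Λ qs
          (fun q => (C : EReal) * Forecast.rate Λ (Forecast.featureRadius Ψ) qs q) ω) := by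
  constructor
  · intro Ω _ μ _ 𝒳 _ ℋ _ _ _ Z κ 𝒴 Ψ T p Λ hp h qs
    obtain ⟨E, hEm, hE, hb⟩ := h.exists_event hp hM hδ qs
    refine ⟨E, hEm, hE, fun ω hω a ha q hq _ => ?_⟩
    -- For an empty sample no `q` has `0 < ‖q - q*‖₁`.
    have hT : 1 ≤ T := by
      rcases Nat.eq_zero_or_pos T with rfl | hT
      · simp [Forecast.l1] at hq
      · exact hT
    refine Forecast.coe_le_coe_add (hb ω hω a ha q) (Forecast.excess_le_penalty hM ?_ qs q)
    exact mul_nonneg (mul_nonneg (Forecast.constT_nonneg (by linarith) (by linarith) hT)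
      ((norm_nonneg a).trans ha)) (Real.sqrt_nonneg _)
  · refine ⟨Forecast.rateConst M δ, by unfold Forecast.rateConst; positivity, ?_⟩
    intro Ω _ μ _ 𝒳 _ ℋ _ _ _ Z κ 𝒴 Ψ T Λ hT h qs
    obtain ⟨E, hEm, hE, hb⟩ := h.exists_event one_le_two hM hδ qs
    refine ⟨E, hEm, hE, fun ω hω a ha q _ _ => ?_⟩
    exact Forecast.coe_le_coe_add (hb ω hω a ha q) (Forecast.excess_le_rate hM hT
      (mul_nonneg ((norm_nonneg a).trans ha) (Real.sqrt_nonneg _)) qs q)
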